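/- Let $\bar A\in\mathbb R^{n\times n}$ have spectral radius $\rho<1$, let $\bar a_i^T$ be its $i$-th row, and let $\psi>0$ satisfy $\sum_{t\ge 0}\|\bar A^t\|_2\le \psi/(1-\rho)$ (such a $\psi$ always exists; any $\psi$ with $\|\bar A^t\|_2\le\psi\rho^t$ for all $t\ge0$ qualifies). Consider random vectors in $\mathbb R^n$ with $x_{t+1}=\bar A x_t+w_t+v_t$, $t=0,\dots,T-1$, and put $\mathcal F_t=\sigma(x_0,\dots,x_t)$. For a random vector $X$, $\|X\|_{\psi_2}\le\sigma$ means $\mathbb E\exp(\langle u,X\rangle^2/\sigma^2)\le 2$ for all unit vectors $u$ (conditionally: with the conditional expectation, almost surely). Let $\sigma_w,\sigma_v,\lambda>0$ and $0\le p<1/2$, and assume: (i) $\|x_0\|_{\psi_2}\le\sigma_v$; for each $t<T$, $\|v_t\|_{\psi_2}\le\sigma_v$ conditionally on $\mathcal F_t$, $\|w_t\|_{\psi_2}\le\sigma_w$, $\mathbb E w_t=0$, and $w_t$ is independent of $(x_0,v_0,\dots,v_t,w_0,\dots,w_{t-1})$; (ii) for each $i\in\{1,\dots,n\}$ there are $\mathrm{Bernoulli}(p)$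 variables $\xi^{(i)}_0,\dots,\xi^{(i)}_{T-1}$, with $\xi^{(i)}_t$ independent of $\mathcal F_t$ and $\xi^{(i)}_0,\dots,\xi^{(i)}_{t-1}$ jointly, such that $\{\xi^{(i)}_t=0\}\subseteq\{v^{(i)}_t=0\}$ for all $t<T$; (iii) $\mathbb E[x_tx_t^T\mid\mathcal F_{t-1}]\succeq\lambda^2 I$ almost surely for $t=1,\dots,T$. Let $\tilde x_{t+1}=x_{t+1}-w_t$ and $\tilde f^{(i)}_T(a)=\sum_{t=0}^{T-1}|\tilde x^{(i)}_{t+1}-a^Tx_t|$. Then there are an absolute constant $\gamma>0$ and a constant $C>0$ depending only on $\psi$ such that, for every $\delta\in(0,1]$, whenever $$T\ \ge\ C\,\max\Bigl\{\tfrac{(\sigma_w+\sigma_v)^4}{\lambda^4(1-2p)},\ \tfrac{(\sigma_w+\sigma_v)^{10}}{\lambda^{10}(1-2p)^2(1-\rho)^2}\Bigr\}\Bigl[n\log\Bigl(\tfrac{n(\sigma_w+\sigma_v)}{\lambda(1-2p)(1-\rho)}\Bigr)+\log\bigl(\tfrac n\delta\bigr)\Bigr],$$ with probability at least $1-\delta$,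 $$\tilde f_T^{(i)}(a)-\tilde f_T^{(i)}(\bar a_i)\ \ge\ \gamma\,T\,\frac{\lambda^5(1-2p)}{(\sigma_w+\sigma_v)^4}\,\|a-\bar a_i\|_2\qquad\text{for all } a\in\mathbb R^n \text{ and all } i=1,\dots,n .$$ -/

import Mathlib

open MeasureTheory ProbabilityTheory

noncomputable section

namespace AttackedSystem

/-- Euclidean space `ℝⁿ`. -/
abbrev Vec (n : ℕ) : Type := EuclideanSpace ℝ (Fin n)

/-- The spectral radius (largest modulus of a complex eigenvalue) of a real square matrix. -/
def specRad {n : ℕ} (A : Matrix (Fin n) (Fin n) ℝ) : ℝ :=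
  (spectralRadius ℂ (A.map (algebraMap ℝ ℂ))).toReal

/-- The operator norm of a real square matrix acting on Euclidean space. -/
def opNorm {n : ℕ} (A : Matrix (Fin n) (Fin n) ℝ) : ℝ :=
  ‖Matrix.toEuclideanCLM (𝕜 := ℝ) A‖

/-- The `i`-th row of a matrix, as a Euclidean vector. -/
def rowVec {n : ℕ} (A : Matrix (Fin n) (Fin n) ℝ) (i : Fin n) : Vec n :=
  WithLp.toLp 2 (A i)

/-- `∑ₜ ‖Aᵗ‖₂ ≤ ψ / (1 - ρ)` with `ρ` the spectral radius of `A`. Every `A` with `ρ < 1` admits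
such a `ψ`; if `‖Aᵗ‖₂ ≤ ψ ρᵗ` for all `t`, then this very `ψ` works. -/
def PowerSumBound {n : ℕ} (A : Matrix (Fin n) (Fin n) ℝ) (ψ : ℝ) : Prop :=
  ∀ s : ℕ, ∑ t ∈ Finset.range s, opNorm (A ^ t) ≤ ψ / (1 - specRad A)

section Probability

variable {Ω : Type*} [MeasurableSpace Ω] {n : ℕ}

/-- The σ-algebra generated by a random variable. -/
abbrev sigmaOf {β : Type*} [MeasurableSpace β] (X : Ω → β) : MeasurableSpace Ω :=
  MeasurableSpace.comap X inferInstance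

/-- `𝓕ₜ = σ(x₀, …, xₜ)`. -/
abbrev hist (x : ℕ → Ω → Vec n) (t : ℕ) : MeasurableSpace Ω :=
  ⨆ s : ℕ, ⨆ _ : s ≤ t, sigmaOf (x s)

/-- `‖X‖_{ψ₂} ≤ σ` for a random vector and `σ > 0`, i.e. `E exp(⟨u, X⟩² / σ²) ≤ 2` for every unit
vector `u` (no centering). -/
def Psi2Le (μ : Measure Ω) (X : Ω → Vec n) (σ : ℝ) : Prop :=
  ∀ u : Vec n, ‖u‖ = 1 →
    Integrable (fun ω => Real.exp ((inner ℝ u (X ω)) ^ 2 / σ ^ 2)) μ ∧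
      ∫ ω, Real.exp ((inner ℝ u (X ω)) ^ 2 / σ ^ 2) ∂μ ≤ 2

/-- `‖X‖_{ψ₂} ≤ σ` conditionally on the σ-algebra `m`, almost surely. -/
def CondPsi2Le (μ : Measure Ω) (m : MeasurableSpace Ω) (X : Ω → Vec n) (σ : ℝ) : Prop :=
  ∀ u : Vec n, ‖u‖ = 1 →
    Integrable (fun ω => Real.exp ((inner ℝ u (X ω)) ^ 2 / σ ^ 2)) μ ∧
      ∀ᵐ ω ∂μ, (μ[fun ω' => Real.exp ((inner ℝ u (X ω')) ^ 2 / σ ^ 2) | m]) ω ≤ 2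

/-- The dynamics `x_{t+1} = A xₜ + wₜ + vₜ` for `t = 0, …, T - 1`. -/
def Dynamics (A : Matrix (Fin n) (Fin n) ℝ) (x w v : ℕ → Ω → Vec n) (T : ℕ) : Prop :=
  ∀ t < T, ∀ ω, x (t + 1) ω = Matrix.toEuclideanCLM (𝕜 := ℝ) A (x t ω) + w t ω + v t ω

/-- Sub-Gaussian noise, attack and initial state. The noise `wₜ` has mean zero and is independent
of everything determined before it: `x₀`, the attacks `v₀, …, vₜ` and the noises
`w₀, …, w_{t-1}`. Later attacks may depend on `wₜ` through the states. -/
structure SubGaussianNoiseAttack (μ : Measure Ω) (x w v : ℕ → Ω → Vec n)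
    (σw σv : ℝ) (T : ℕ) : Prop where
  meas_init : Measurable (x 0)
  meas_noise : ∀ t < T, Measurable (w t)
  meas_attack : ∀ t < T, Measurable (v t)
  init_psi2 : Psi2Le μ (x 0) σv
  attack_psi2 : ∀ t < T, CondPsi2Le μ (hist x t) (v t) σv
  noise_psi2 : ∀ t < T, Psi2Le μ (w t) σw
  noise_mean : ∀ t < T, ∫ ω, w t ω ∂μ = 0
  noise_indep : ∀ t < T,
    Indep (sigmaOf (w t))
      (sigmaOf (x 0) ⊔ (⨆ s : ℕ, ⨆ _ : s ≤ t, sigmaOf (v s)) ⊔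
        (⨆ s : ℕ, ⨆ _ : s < t, sigmaOf (w s))) μ

/-- Node-wise probabilistic attack: for every node `i` there are `Bernoulli(p)` variables
`ξ₀, …, ξ_{T-1}`, each independent of the history `𝓕ₜ` and the earlier `ξ`'s (in particular they
are mutually independent), such that node `i` is not attacked at time `t` when `ξₜ = 0`. No
relation between the `ξ`'s of different nodes is required. -/
def NodeWiseAttack (μ : Measure Ω) (x v : ℕ → Ω → Vec n) (p : ℝ) (T : ℕ) : Prop :=
  ∀ i : Fin n, ∃ ξ : ℕ → Ω → Bool,
    (∀ t < T, Measurable (ξ t)) ∧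
    (∀ t < T, μ.real {ω | ξ t ω = true} = p) ∧
    (∀ t < T, Indep (sigmaOf (ξ t)) (hist x t ⊔ ⨆ s : ℕ, ⨆ _ : s < t, sigmaOf (ξ s)) μ) ∧
    (∀ t < T, ∀ ω, ξ t ω = false → v t ω i = 0)

/-- Expected excitation: `E[xₜ xₜᵀ | 𝓕_{t-1}] ⪰ l² I` almost surely, for `t = 1, …, T`. -/
def ExpectedExcitation (μ : Measure Ω) (x : ℕ → Ω → Vec n) (l : ℝ) (T : ℕ) : Prop :=
  ∀ t < T, ∀ᵐ ω ∂μ,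
    ((Matrix.of fun j k : Fin n =>
        (μ[fun ω' => x (t + 1) ω' j * x (t + 1) ω' k | hist x t]) ω)
      - l ^ 2 • (1 : Matrix (Fin n) (Fin n) ℝ)).PosSemidef

/-- The row-wise `ℓ₁` objective `∑_{t<T} |x̃_{t+1}⁽ⁱ⁾ - aᵀ xₜ|` of the noise-aware system, with
`x̃_{t+1} = x_{t+1} - wₜ`, on the sample `ω`. -/
def noiseAwareObj (x w : ℕ → Ω → Vec n) (T : ℕ) (i : Fin n) (a : Vec n) (ω : Ω) : ℝ :=
  ∑ t ∈ Finset.range T, |(x (t + 1) ω - w t ω) i - inner ℝ a (x t ω)|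

end Probability

end AttackedSystem

end

/-! Fix a row `i` and let `d` be the unit direction of `a - rowVec A i`. When `ξₜ = 0` the loss term
grows by exactly `|⟨a - āᵢ, xₜ⟩|`; when `ξₜ = 1` it drops by at most that much. The excess is
therefore at least `‖a - āᵢ‖` times the signed sum `∑ (1 - 2ξₜ)|⟨d, xₜ⟩|`, and it suffices to bound
this sum below by a multiple of `T`, uniformly over the unit sphere. It splits as `(1 - 2p) ∑ |⟨d,
xₜ⟩| - 2 ∑ (ξₜ - p)|⟨d, xₜ⟩|`.

The first part is large by a conditional small-ball estimate (`smallBall_measure`): excitation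
bounds the conditional second moment below, sub-Gaussianity controls the fourth, so `|⟨d, xₜ⟩| ≥
l/2` has conditional probability at least `q = l⁴/(1328σ⁴)`, where `σ = σw + σv`; Chernoff's bound
counts these times. The second part is a martingale transform, since `ξₜ` is independent of `x₀, …,
xₜ`; `measureReal_bernoulli_sum_le` controls it through the energy `∑ ⟨d, xₜ⟩²`. The energy is at
most `2S²σ²T` with `S = ψ/(1 - ρ)`, because the state is a convolution of conditionally sub-Gaussian
innovations with the powers of `A`, whose norms sum to at most `S` (`measureReal_energy_le`).

Uniformity comes from a net of the sphere. Its mesh is polynomial in `Λ = nσ/(l(1 - 2p)(1 - ρ))`, so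
its log-cardinality is of order `n log Λ` up to a factor depending on `ψ`, which the sample size
pays for. This needs `log Λ` bounded away from zero. Comparing the excitation of `x₁` with its
sub-Gaussian size, in a direction where the transpose expands by at most `ρ`, gives `Λ ≥ 7/6`
(`excitation_le`). -/

namespace AttackedSystem

/-! ### Conditional bounds tested on sets, and Chernoff's method -/

section ConditionalBounds

variable {Ω : Type*} {m m' : MeasurableSpace Ω} [m0 : MeasurableSpace Ω]

/-- The conditional expectation of `f` given `m` is at most `c`, expressed through integrals over
the sets of `m`. -/
def CondLIntegralLe (μ : Measure Ω) (m : MeasurableSpace Ω) (f : Ω → ENNReal) (c : ENNReal) :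
    Prop :=
  ∀ B, MeasurableSet[m] B → ∫⁻ ω in B, f ω ∂μ ≤ c * μ B

theorem CondLIntegralLe.mono_fun {μ : Measure Ω} {f g : Ω → ENNReal}
    {c : ENNReal} (h : CondLIntegralLe μ m g c) (hfg : ∀ ω, f ω ≤ g ω) :
    CondLIntegralLe μ m f c :=
  fun B hB => (lintegral_mono hfg).trans (h B hB)

/-- The set-wise bound says that the measure with density `f`, restricted to `m`, is dominated by `c
• μ`. Integrating an `m`-measurable `g` against both measures gives the claim, with no integrability
needed. -/
theorem CondLIntegralLe.lintegral_mul_le {μ : Measure Ω}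
    {f g : Ω → ENNReal} {c : ENNReal} (h : CondLIntegralLe μ m f c) (hm : m ≤ m0)
    (hf : Measurable f) (hg : Measurable[m] g) :
    ∫⁻ ω, g ω * f ω ∂μ ≤ c * ∫⁻ ω, g ω ∂μ := by
  have hle : (μ.withDensity f).trim hm ≤ c • μ.trim hm := by
    refine Measure.le_iff.2 fun B hB => ?_
    rw [trim_measurableSet_eq hm hB, withDensity_apply _ (hm _ hB), Measure.smul_apply,
      trim_measurableSet_eq hm hB, smul_eq_mul]
    exact h B hB
  calc ∫⁻ ω, g ω * f ω ∂μ = ∫⁻ ω, (f * g) ω ∂μ := by simp only [Pi.mul_apply, mul_comm]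
    _ = ∫⁻ ω, g ω ∂(μ.withDensity f) :=
        (lintegral_withDensity_eq_lintegral_mul μ hf (hg.mono hm le_rfl)).symm
    _ = ∫⁻ ω, g ω ∂((μ.withDensity f).trim hm) := (lintegral_trim hm hg).symm
    _ ≤ ∫⁻ ω, g ω ∂(c • μ.trim hm) := lintegral_mono' hle le_rfl
    _ = c * ∫⁻ ω, g ω ∂μ := by rw [lintegral_smul_measure, lintegral_trim hm hg, smul_eq_mul]

/-- The last factor is peeled off by conditioning on its past, to which all earlier factors are
adapted; iterating gives one `c` per step. -/
theorem lintegral_prod_le_pow {μ : Measure Ω} [IsProbabilityMeasure μ]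
    (F : ℕ → MeasurableSpace Ω) (h : ℕ → Ω → ENNReal) (c : ENNReal) (T : ℕ)
    (hF : ∀ t < T, F t ≤ m0) (hmeas : ∀ t < T, Measurable (h t))
    (hadapt : ∀ t < T, ∀ s < t, Measurable[F t] (h s))
    (hle : ∀ t < T, CondLIntegralLe μ (F t) (h t) c) :
    ∫⁻ ω, ∏ t ∈ Finset.range T, h t ω ∂μ ≤ c ^ T := by
  induction T with
  | zero => simp
  | succ T ih =>
    simp only [Finset.prod_range_succ]
    have hg : Measurable[F T] fun ω => ∏ t ∈ Finset.range T, h t ω :=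
      Finset.measurable_prod _ fun t ht =>
        hadapt T (Nat.lt_succ_self T) t (Finset.mem_range.1 ht)
    refine ((hle T (Nat.lt_succ_self T)).lintegral_mul_le (hF T (Nat.lt_succ_self T))
      (hmeas T (Nat.lt_succ_self T)) hg).trans ?_
    rw [pow_succ, mul_comm]
    gcongr
    exact ih (fun t ht => hF t (by omega)) (fun t ht => hmeas t (by omega))
      (fun t ht => hadapt t (by omega)) (fun t ht => hle t (by omega))

/-- Chernoff's bound for a sum of adapted variables with conditionally bounded exponential
moments. -/
theorem measureReal_le_sum_le_exp {μ : Measure Ω} [IsProbabilityMeasure μ]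
    (F : ℕ → MeasurableSpace Ω) (Y : ℕ → Ω → ℝ) (b : ℝ) (T : ℕ)
    (hF : ∀ t < T, F t ≤ m0) (hmeas : ∀ t < T, Measurable (Y t))
    (hadapt : ∀ t < T, ∀ s < t, Measurable[F t] (Y s))
    (hle : ∀ t < T, CondLIntegralLe μ (F t) (fun ω => ENNReal.ofReal (Real.exp (Y t ω)))
      (ENNReal.ofReal (Real.exp b))) (a : ℝ) :
    μ.real {ω | a ≤ ∑ t ∈ Finset.range T, Y t ω} ≤ Real.exp (T * b - a) := by
  have h1 := lintegral_prod_le_pow (μ := μ) F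
    (fun t ω => ENNReal.ofReal (Real.exp (Y t ω))) (ENNReal.ofReal (Real.exp b)) T hF
    (fun t ht => (Real.measurable_exp.comp (hmeas t ht)).ennreal_ofReal)
    (fun t ht s hs => (Real.measurable_exp.comp (hadapt t ht s hs)).ennreal_ofReal) hle
  have h2 : ∀ ω, ∏ t ∈ Finset.range T, ENNReal.ofReal (Real.exp (Y t ω))
      = ENNReal.ofReal (Real.exp (∑ t ∈ Finset.range T, Y t ω)) := fun ω => by
    rw [Real.exp_sum, ENNReal.ofReal_prod_of_nonneg fun _ _ => (Real.exp_pos _).le]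
  simp only [h2] at h1
  rw [← ENNReal.ofReal_pow (Real.exp_pos b).le, ← Real.exp_nat_mul] at h1
  have hm : Measurable fun ω => ∑ t ∈ Finset.range T, Y t ω :=
    Finset.measurable_sum _ fun t ht => hmeas t (Finset.mem_range.1 ht)
  have h3 := (mul_meas_ge_le_lintegral (μ := μ)
    ((Real.measurable_exp.comp hm).ennreal_ofReal) (ENNReal.ofReal (Real.exp a))).trans h1
  have hset : {ω | ENNReal.ofReal (Real.exp a) ≤
      (fun ω => ENNReal.ofReal ((Real.exp ∘ fun ω => ∑ t ∈ Finset.range T, Y t ω) ω)) ω}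
      = {ω | a ≤ ∑ t ∈ Finset.range T, Y t ω} := by
    ext ω
    simp [ENNReal.ofReal_le_ofReal_iff (Real.exp_pos _).le]
  rw [hset] at h3
  have h4 := ENNReal.toReal_mono ENNReal.ofReal_ne_top h3
  rw [ENNReal.toReal_mul, ENNReal.toReal_ofReal (Real.exp_pos _).le,
    ENNReal.toReal_ofReal (Real.exp_pos _).le] at h4
  rw [Real.exp_sub, le_div_iff₀ (Real.exp_pos a), mul_comm]
  exact h4

theorem CondLIntegralLe.integrable {μ : Measure Ω} [IsFiniteMeasure μ]
    {f : Ω → ℝ} {c : ℝ} (h : CondLIntegralLe μ m (fun ω => ENNReal.ofReal (f ω))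
      (ENNReal.ofReal c)) (hf : Measurable f) (hf0 : ∀ ω, 0 ≤ f ω) : Integrable f μ := by
  refine ⟨hf.aestronglyMeasurable, ?_⟩
  rw [hasFiniteIntegral_iff_ofReal (ae_of_all _ hf0)]
  have := h Set.univ MeasurableSet.univ
  rw [Measure.restrict_univ] at this
  exact this.trans_lt (ENNReal.mul_lt_top ENNReal.ofReal_lt_top (measure_lt_top _ _))

theorem CondLIntegralLe.setIntegral_le {μ : Measure Ω} [IsFiniteMeasure μ]
    {f : Ω → ℝ} {c : ℝ} (hc : 0 ≤ c)
    (h : CondLIntegralLe μ m (fun ω => ENNReal.ofReal (f ω)) (ENNReal.ofReal c))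
    (hf : Measurable f) (hf0 : ∀ ω, 0 ≤ f ω) {B : Set Ω} (hB : MeasurableSet[m] B) :
    ∫ ω in B, f ω ∂μ ≤ c * μ.real B := by
  rw [integral_eq_lintegral_of_nonneg_ae (ae_of_all _ hf0) hf.aestronglyMeasurable]
  have := ENNReal.toReal_mono
    (ENNReal.mul_lt_top ENNReal.ofReal_lt_top (measure_lt_top _ _)).ne (h B hB)
  rwa [ENNReal.toReal_mul, ENNReal.toReal_ofReal hc] at this

theorem condLIntegralLe_ofReal {μ : Measure Ω} [IsFiniteMeasure μ]
    {f : Ω → ℝ} {c : ℝ} (hc : 0 ≤ c) (hf : Integrable f μ) (hf0 : ∀ ω, 0 ≤ f ω)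
    (h : ∀ B, MeasurableSet[m] B → ∫ ω in B, f ω ∂μ ≤ c * μ.real B) :
    CondLIntegralLe μ m (fun ω => ENNReal.ofReal (f ω)) (ENNReal.ofReal c) := by
  intro B hB
  rw [← ofReal_integral_eq_lintegral_ofReal hf.integrableOn (ae_of_all _ hf0)]
  refine (ENNReal.ofReal_le_ofReal (h B hB)).trans ?_
  rw [ENNReal.ofReal_mul hc, Measure.real, ENNReal.ofReal_toReal (measure_ne_top _ _)]

theorem condLIntegralLe_of_condExp_le {μ : Measure Ω} [IsFiniteMeasure μ]
    (hm : m ≤ m0) {f : Ω → ℝ} {c : ℝ} (hc : 0 ≤ c)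
    (hf : Integrable f μ) (hf0 : ∀ ω, 0 ≤ f ω) (h : ∀ᵐ ω ∂μ, (μ[f | m]) ω ≤ c) :
    CondLIntegralLe μ m (fun ω => ENNReal.ofReal (f ω)) (ENNReal.ofReal c) := by
  refine condLIntegralLe_ofReal hc hf hf0 fun B hB => ?_
  rw [← setIntegral_condExp hm hf hB]
  calc ∫ ω in B, (μ[f | m]) ω ∂μ ≤ ∫ _ in B, c ∂μ :=
        integral_mono_ae integrable_condExp.integrableOn (integrable_const _).integrableOn
          (ae_restrict_of_ae h)
    _ = c * μ.real B := by simp [mul_comm]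

theorem condLIntegralLe_of_indep {μ : Measure Ω} [IsFiniteMeasure μ]
    (hm : m ≤ m0) (hm' : m' ≤ m0) (hind : Indep m' m μ)
    {f : Ω → ℝ} {c : ℝ} (hf : Integrable f μ) (hfm : Measurable[m'] f)
    (hf0 : ∀ ω, 0 ≤ f ω) (h : ∫ ω, f ω ∂μ ≤ c) :
    CondLIntegralLe μ m (fun ω => ENNReal.ofReal (f ω)) (ENNReal.ofReal c) := by
  intro B hB
  have h1 := lintegral_mul_indicator_eq_lintegral_mul_lintegral_indicator (μ := μ) hm' 1
    (hm _ hB) (by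
      rw [Indep_iff] at hind
      rw [IndepSets_iff]
      rintro t1 t2 ht1 rfl
      exact hind t1 t2 ht1 hB) hfm.ennreal_ofReal
  have h2 : ∀ ω, ENNReal.ofReal (f ω) * B.indicator (fun _ => (1 : ENNReal)) ω
      = B.indicator (fun ω => ENNReal.ofReal (f ω)) ω := fun ω => by
    by_cases hω : ω ∈ B <;> simp [hω]
  simp only [h2] at h1
  rw [lintegral_indicator (hm _ hB), lintegral_indicator_const (hm _ hB), one_mul] at h1
  rw [h1, ← ofReal_integral_eq_lintegral_ofReal hf (ae_of_all _ hf0)]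
  gcongr

theorem CondLIntegralLe.finset_sum {μ : Measure Ω} {ι : Type*}
    (s : Finset ι) (w : ι → ℝ) (f : ι → Ω → ℝ) {c : ℝ} (hw : ∀ k ∈ s, 0 ≤ w k)
    (hw1 : ∑ k ∈ s, w k = 1) (hfm : ∀ k ∈ s, Measurable (f k)) (hf0 : ∀ k ω, 0 ≤ f k ω)
    (h : ∀ k ∈ s, CondLIntegralLe μ m (fun ω => ENNReal.ofReal (f k ω)) (ENNReal.ofReal c)) :
    CondLIntegralLe μ m (fun ω => ENNReal.ofReal (∑ k ∈ s, w k * f k ω))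
      (ENNReal.ofReal c) := by
  intro B hB
  have h1 : ∀ ω, ENNReal.ofReal (∑ k ∈ s, w k * f k ω)
      = ∑ k ∈ s, ENNReal.ofReal (w k) * ENNReal.ofReal (f k ω) := fun ω => by
    rw [ENNReal.ofReal_sum_of_nonneg fun k hk => mul_nonneg (hw k hk) (hf0 k ω)]
    exact Finset.sum_congr rfl fun k hk => ENNReal.ofReal_mul (hw k hk)
  simp only [h1]
  rw [lintegral_finsetSum' _ fun k hk =>
    ((hfm k hk).ennreal_ofReal.const_mul _).aemeasurable]
  calc ∑ k ∈ s, ∫⁻ ω in B, ENNReal.ofReal (w k) * ENNReal.ofReal (f k ω) ∂μ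
      ≤ ∑ k ∈ s, ENNReal.ofReal (w k) * (ENNReal.ofReal c * μ B) := by
        refine Finset.sum_le_sum fun k hk => ?_
        rw [lintegral_const_mul _ (hfm k hk).ennreal_ofReal]
        gcongr
        exact h k hk B hB
    _ = ENNReal.ofReal c * μ B := by
        rw [← Finset.sum_mul, ← ENNReal.ofReal_sum_of_nonneg hw, hw1, ENNReal.ofReal_one,
          one_mul]

theorem CondLIntegralLe.convex_comb {μ : Measure Ω}
    {a b : ℝ} {f g : Ω → ℝ} {c : ℝ} (ha : 0 ≤ a) (hb : 0 ≤ b) (hab : a + b = 1)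
    (hfm : Measurable f) (hgm : Measurable g) (hf0 : ∀ ω, 0 ≤ f ω) (hg0 : ∀ ω, 0 ≤ g ω)
    (hf : CondLIntegralLe μ m (fun ω => ENNReal.ofReal (f ω)) (ENNReal.ofReal c))
    (hg : CondLIntegralLe μ m (fun ω => ENNReal.ofReal (g ω)) (ENNReal.ofReal c)) :
    CondLIntegralLe μ m (fun ω => ENNReal.ofReal (a * f ω + b * g ω)) (ENNReal.ofReal c) := by
  have := CondLIntegralLe.finset_sum (μ := μ) (m := m) (c := c) Finset.univ ![a, b] ![f, g]
    (by simp [Fin.forall_fin_two, ha, hb]) (by simpa using hab)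
    (by simp [Fin.forall_fin_two, hfm, hgm])
    (by simp [Fin.forall_fin_two, hf0, hg0]) (by simp [Fin.forall_fin_two, hf, hg])
  simpa using this

end ConditionalBounds

/-! ### Small-ball estimate and Bernoulli martingale transforms -/

section ConditionalEstimates

variable {Ω : Type*} {m : MeasurableSpace Ω} [m0 : MeasurableSpace Ω]

theorem measurableSet_half_le {X : Ω → ℝ} (hX : Measurable X) (l : ℝ) :
    MeasurableSet {ω | l / 2 ≤ |X ω|} :=
  measurableSet_le measurable_const hX.abs

theorem sq_le_exp_of_nonneg {y : ℝ} (hy : 0 ≤ y) : y + y ^ 2 / 2 ≤ Real.exp y - 1 := by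
  have := Real.quadratic_le_exp_of_nonneg hy
  linarith

/-- A conditional Paley–Zygmund inequality for a sub-Gaussian variable shifted by a
conditionally deterministic amount. -/
theorem smallBall_measure {μ : Measure Ω} [IsProbabilityMeasure μ] (hm : m ≤ m0)
    {X M Z : Ω → ℝ} {σ l : ℝ} (hσ : 0 < σ) (hl : 0 < l) (hlσ : l ≤ 2 * σ)
    (hM : Measurable[m] M) (hZ : Measurable Z) (hX : ∀ ω, X ω = M ω + Z ω)
    (hψ : CondLIntegralLe μ m (fun ω => ENNReal.ofReal (Real.exp (Z ω ^ 2 / σ ^ 2)))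
      (ENNReal.ofReal 2))
    (hexc : ∀ B, MeasurableSet[m] B → l ^ 2 * μ.real B ≤ ∫ ω in B, X ω ^ 2 ∂μ)
    {B : Set Ω} (hB : MeasurableSet[m] B) :
    l ^ 4 / (1328 * σ ^ 4) * μ.real B ≤ μ.real (B ∩ {ω | l / 2 ≤ |X ω|}) := by
  have hexp : Measurable fun ω => Real.exp (Z ω ^ 2 / σ ^ 2) := by fun_prop
  have hexp0 : ∀ ω, 0 ≤ Real.exp (Z ω ^ 2 / σ ^ 2) := fun ω => (Real.exp_pos _).le
  have hint : Integrable (fun ω => Real.exp (Z ω ^ 2 / σ ^ 2)) μ := hψ.integrable hexp hexp0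
  have hint1 : Integrable (fun ω => Real.exp (Z ω ^ 2 / σ ^ 2) - 1) μ :=
    hint.sub (integrable_const _)
  have hM0 : Measurable M := hM.mono hm le_rfl
  have hXm : Measurable X := by
    have : X = fun ω => M ω + Z ω := funext hX
    rw [this]; exact hM0.add hZ
  have hE := measurableSet_half_le hXm l
  set E := {ω | l / 2 ≤ |X ω|} with hEdef
  have hσ2 : 0 < σ ^ 2 := by positivity
  have hZ2 : ∀ ω, Z ω ^ 2 ≤ σ ^ 2 * (Real.exp (Z ω ^ 2 / σ ^ 2) - 1) := fun ω => by
    have h := sq_le_exp_of_nonneg (y := Z ω ^ 2 / σ ^ 2) (by positivity)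
    have h' : Z ω ^ 2 / σ ^ 2 ≤ Real.exp (Z ω ^ 2 / σ ^ 2) - 1 := by
      nlinarith [sq_nonneg (Z ω ^ 2 / σ ^ 2)]
    rwa [div_le_iff₀ hσ2, mul_comm] at h'
  have hZ4 : ∀ ω, Z ω ^ 4 ≤ 2 * σ ^ 4 * (Real.exp (Z ω ^ 2 / σ ^ 2) - 1) := fun ω => by
    have h := sq_le_exp_of_nonneg (y := Z ω ^ 2 / σ ^ 2) (by positivity)
    have h' : Z ω ^ 4 / (2 * σ ^ 4) ≤ Real.exp (Z ω ^ 2 / σ ^ 2) - 1 := by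
      have e : Z ω ^ 4 / (2 * σ ^ 4) = (Z ω ^ 2 / σ ^ 2) ^ 2 / 2 := by field_simp
      have : 0 ≤ Z ω ^ 2 / σ ^ 2 := by positivity
      rw [e]; linarith
    rwa [div_le_iff₀ (by positivity), mul_comm] at h'
  have hexpB : ∀ B, MeasurableSet[m] B →
      ∫ ω in B, Real.exp (Z ω ^ 2 / σ ^ 2) ∂μ ≤ 2 * μ.real B := fun B hB =>
    hψ.setIntegral_le (by norm_num) hexp hexp0 hB
  have hindE : Integrable (E.indicator fun _ => (1 : ℝ)) μ :=
    (integrable_const _).indicator hE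
  have hEint : ∀ B, MeasurableSet[m] B →
      ∫ ω in B, E.indicator (fun _ => (1 : ℝ)) ω ∂μ = μ.real (B ∩ E) := fun B hB => by
    rw [setIntegral_indicator hE]; simp
  -- the part where the shift is small
  have hsmall : ∀ B, MeasurableSet[m] B → (∀ ω ∈ B, |M ω| ≤ 3 * σ) →
      l ^ 4 / (1328 * σ ^ 4) * μ.real B ≤ μ.real (B ∩ E) := by
    intro B hB hMB
    -- Paley–Zygmund in pointwise form. Off `E`, `X² ≤ l²/4`; on `E`, AM–GM trades `X²` for a
    -- constant plus a small multiple of `X⁴`. As `X⁴ ≤ 8(M⁴ + Z⁴)` and `Z⁴` has conditional mean at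
    -- most `2σ⁴`, the fourth moment is at most `8(81 + 2)σ⁴ = 664σ⁴`. The weight `l²/(1328σ⁴)`
    -- turns this into `l²/2`, leaving `l²/4` for the probability of `E`.
    have hpt : ∀ ω ∈ B, X ω ^ 2 ≤ l ^ 2 / 4 + 332 * σ ^ 4 / l ^ 2 *
        E.indicator (fun _ => (1 : ℝ)) ω + l ^ 2 / (166 * σ ^ 4) * (81 * σ ^ 4 +
        2 * σ ^ 4 * (Real.exp (Z ω ^ 2 / σ ^ 2) - 1)) := by
      intro ω hω
      have hR : 0 ≤ l ^ 2 / (166 * σ ^ 4) * (81 * σ ^ 4 +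
          2 * σ ^ 4 * (Real.exp (Z ω ^ 2 / σ ^ 2) - 1)) := by
        have : 0 ≤ Z ω ^ 4 := by positivity
        have := hZ4 ω
        have : 0 ≤ 81 * σ ^ 4 := by positivity
        refine mul_nonneg (by positivity) (by linarith)
      by_cases hωE : ω ∈ E
      · rw [Set.indicator_of_mem hωE, mul_one]
        have hX4 : X ω ^ 4 ≤ 8 * (81 * σ ^ 4 + Z ω ^ 4) := by
          have h1 : M ω ^ 4 ≤ 81 * σ ^ 4 := by
            have := pow_le_pow_left₀ (abs_nonneg (M ω)) (hMB ω hω) 4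
            rw [Even.pow_abs (by decide)] at this
            linarith [show (3 * σ) ^ 4 = 81 * σ ^ 4 by ring]
          have h2 : (M ω + Z ω) ^ 4 ≤ 8 * (M ω ^ 4 + Z ω ^ 4) := by
            nlinarith [sq_nonneg (M ω - Z ω), sq_nonneg (M ω ^ 2 - Z ω ^ 2),
              sq_nonneg ((M ω - Z ω) ^ 2), sq_nonneg (M ω + Z ω), sq_nonneg (M ω ^ 2 + Z ω ^ 2),
              mul_nonneg (sq_nonneg (M ω - Z ω)) (sq_nonneg (M ω + Z ω))]
          rw [hX]; linarith
        have ham : X ω ^ 2 ≤ 332 * σ ^ 4 / l ^ 2 + l ^ 2 / (1328 * σ ^ 4) * X ω ^ 4 := by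
          have hk : 0 < l ^ 2 / (1328 * σ ^ 4) := by positivity
          have e : 332 * σ ^ 4 / l ^ 2 = 1 / (4 * (l ^ 2 / (1328 * σ ^ 4))) := by
            field_simp; norm_num
          rw [e]
          set k := l ^ 2 / (1328 * σ ^ 4)
          have : 1 / (4 * k) + k * X ω ^ 4 - X ω ^ 2 = (1 - 2 * k * X ω ^ 2) ^ 2 / (4 * k) := by
            field_simp; ring
          have : 0 ≤ (1 - 2 * k * X ω ^ 2) ^ 2 / (4 * k) := by positivity
          linarith
        have h3 : l ^ 2 / (1328 * σ ^ 4) * X ω ^ 4 ≤ l ^ 2 / (166 * σ ^ 4) * (81 * σ ^ 4 +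
          2 * σ ^ 4 * (Real.exp (Z ω ^ 2 / σ ^ 2) - 1)) := by
          calc l ^ 2 / (1328 * σ ^ 4) * X ω ^ 4
              ≤ l ^ 2 / (1328 * σ ^ 4) * (8 * (81 * σ ^ 4 +
                2 * σ ^ 4 * (Real.exp (Z ω ^ 2 / σ ^ 2) - 1))) := by
                refine mul_le_mul_of_nonneg_left (hX4.trans ?_) (by positivity)
                linarith [hZ4 ω]
            _ = _ := by field_simp; ring
        have : 0 ≤ l ^ 2 / 4 := by positivity
        linarith
      · rw [Set.indicator_of_notMem hωE, mul_zero, add_zero]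
        have : |X ω| < l / 2 := by simpa [E] using hωE
        have h4 : X ω ^ 2 ≤ l ^ 2 / 4 := by
          rw [← sq_abs]; nlinarith [abs_nonneg (X ω)]
        linarith
    have hI1 : IntegrableOn (fun ω => l ^ 2 / 4 + 332 * σ ^ 4 / l ^ 2 *
        E.indicator (fun _ => (1 : ℝ)) ω) B μ :=
      ((integrable_const _).add (hindE.const_mul _)).integrableOn
    have hint2 : Integrable (fun ω => 2 * σ ^ 4 * (Real.exp (Z ω ^ 2 / σ ^ 2) - 1)) μ :=
      hint1.const_mul _
    have hI2 : IntegrableOn (fun ω => l ^ 2 / (166 * σ ^ 4) * (81 * σ ^ 4 +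
        2 * σ ^ 4 * (Real.exp (Z ω ^ 2 / σ ^ 2) - 1))) B μ :=
      (((integrable_const _).add (hint1.const_mul _)).const_mul
        _).integrableOn
    have hle : ∫ ω in B, X ω ^ 2 ∂μ ≤ ∫ ω in B, (l ^ 2 / 4 + 332 * σ ^ 4 / l ^ 2 *
        E.indicator (fun _ => (1 : ℝ)) ω + l ^ 2 / (166 * σ ^ 4) * (81 * σ ^ 4 +
        2 * σ ^ 4 * (Real.exp (Z ω ^ 2 / σ ^ 2) - 1))) ∂μ :=
      integral_mono_of_nonneg (ae_of_all _ fun ω => sq_nonneg _) (hI1.add hI2)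
        ((ae_restrict_iff' (hm _ hB)).2 (ae_of_all _ hpt))
    have hval : ∫ ω in B, (l ^ 2 / 4 + 332 * σ ^ 4 / l ^ 2 *
        E.indicator (fun _ => (1 : ℝ)) ω + l ^ 2 / (166 * σ ^ 4) * (81 * σ ^ 4 +
        2 * σ ^ 4 * (Real.exp (Z ω ^ 2 / σ ^ 2) - 1))) ∂μ
        = l ^ 2 / 4 * μ.real B + 332 * σ ^ 4 / l ^ 2 * μ.real (B ∩ E) +
          l ^ 2 / (166 * σ ^ 4) * (81 * σ ^ 4 * μ.real B + 2 * σ ^ 4 *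
          (∫ ω in B, Real.exp (Z ω ^ 2 / σ ^ 2) ∂μ - μ.real B)) := by
      rw [integral_add hI1 hI2, integral_add (integrable_const _).integrableOn
        (hindE.const_mul _).integrableOn, integral_const_mul, integral_const_mul, hEint B hB,
        integral_add (integrable_const _).integrableOn hint2.integrableOn,
        integral_const_mul (2 * σ ^ 4), integral_sub hint.integrableOn (integrable_const _).integrableOn]
      simp [mul_comm]
    rw [hval] at hle
    have h1 := hexc B hB
    have h2 := hexpB B hB
    have h3 : l ^ 2 / (166 * σ ^ 4) * (81 * σ ^ 4 * μ.real B + 2 * σ ^ 4 *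
          (∫ ω in B, Real.exp (Z ω ^ 2 / σ ^ 2) ∂μ - μ.real B)) ≤ l ^ 2 / 2 * μ.real B := by
      calc _ ≤ l ^ 2 / (166 * σ ^ 4) * (81 * σ ^ 4 * μ.real B + 2 * σ ^ 4 *
          (2 * μ.real B - μ.real B)) := by gcongr
        _ = _ := by field_simp; ring
    have h4 : l ^ 2 / 4 * μ.real B ≤ 332 * σ ^ 4 / l ^ 2 * μ.real (B ∩ E) := by linarith
    calc l ^ 4 / (1328 * σ ^ 4) * μ.real B
        = l ^ 2 / (332 * σ ^ 4) * (l ^ 2 / 4 * μ.real B) := by field_simp; ring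
      _ ≤ l ^ 2 / (332 * σ ^ 4) * (332 * σ ^ 4 / l ^ 2 * μ.real (B ∩ E)) := by gcongr
      _ = μ.real (B ∩ E) := by field_simp
  -- the part where the shift is large
  have hlarge : ∀ B, MeasurableSet[m] B → (∀ ω ∈ B, 3 * σ < |M ω|) →
      l ^ 4 / (1328 * σ ^ 4) * μ.real B ≤ μ.real (B ∩ E) := by
    intro B hB hMB
    -- Here missing `E` forces `|Z| ≥ 2σ`, since `l/2 ≤ σ`. Markov's inequality for `exp(Z²/σ²) -
    -- 1`, of conditional mean at most `1`, bounds this probability by `1/4`, however large the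
    -- shift is.
    have hpt : ∀ ω ∈ B, 1 - 1 / 4 * (Real.exp (Z ω ^ 2 / σ ^ 2) - 1) ≤
        E.indicator (fun _ => (1 : ℝ)) ω := by
      intro ω hω
      by_cases hωE : ω ∈ E
      · rw [Set.indicator_of_mem hωE]
        have : 1 ≤ Real.exp (Z ω ^ 2 / σ ^ 2) := Real.one_le_exp (by positivity)
        linarith
      · rw [Set.indicator_of_notMem hωE]
        have h1 : |X ω| < l / 2 := by simpa [E] using hωE
        have h2 := hMB ω hω
        have h3 : |M ω| ≤ |X ω| + |Z ω| := by
          have : M ω = X ω - Z ω := by rw [hX]; ring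
          rw [this]; exact abs_sub _ _
        have h4 : 2 * σ ≤ |Z ω| := by linarith
        have h5 : 4 * σ ^ 2 ≤ Z ω ^ 2 := by
          rw [← sq_abs (Z ω)]; nlinarith
        have h6 : 4 ≤ Real.exp (Z ω ^ 2 / σ ^ 2) - 1 := by
          have := h5.trans (hZ2 ω)
          rw [mul_comm] at this
          exact le_of_mul_le_mul_left this hσ2
        linarith
    have hle : ∫ ω in B, (1 - 1 / 4 * (Real.exp (Z ω ^ 2 / σ ^ 2) - 1)) ∂μ ≤ μ.real (B ∩ E) := by
      rw [← hEint B hB]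
      exact setIntegral_mono_on ((integrable_const _).sub
        (hint1.const_mul _)).integrableOn hindE.integrableOn
        (hm _ hB) hpt
    have hint2 : Integrable (fun ω => 1 / 4 * (Real.exp (Z ω ^ 2 / σ ^ 2) - 1)) μ :=
      hint1.const_mul _
    rw [integral_sub (integrable_const _).integrableOn
      hint2.integrableOn, integral_const_mul,
      integral_sub hint.integrableOn (integrable_const _).integrableOn] at hle
    simp only [integral_const, MeasurableSet.univ, measureReal_restrict_apply, Set.univ_inter,
      smul_eq_mul, mul_one] at hle
    have h2 := hexpB B hB
    have hq : l ^ 4 / (1328 * σ ^ 4) ≤ 3 / 4 := by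
      rw [div_le_iff₀ (by positivity)]
      have := pow_le_pow_left₀ hl.le hlσ 4
      have h0 : 0 < σ ^ 4 := by positivity
      nlinarith [show (2 * σ) ^ 4 = 16 * σ ^ 4 by ring]
    have := mul_le_mul_of_nonneg_right hq (measureReal_nonneg (μ := μ) (s := B))
    linarith
  have hS : MeasurableSet[m] {ω | |M ω| ≤ 3 * σ} :=
    @measurableSet_le _ _ _ _ _ m _ _ _ _ _ (continuous_abs.measurable.comp hM) measurable_const
  have h1 := hsmall _ (hB.inter hS) fun ω hω => hω.2
  have h2 := hlarge _ (hB.diff hS) fun ω hω => not_le.1 hω.2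
  have h3 := measureReal_inter_add_sdiff (μ := μ) (s := B) (hm _ hS)
  have h4 := measureReal_inter_add_sdiff (μ := μ) (s := B ∩ E) (hm _ hS)
  have e1 : B ∩ E ∩ {ω | |M ω| ≤ 3 * σ} = B ∩ {ω | |M ω| ≤ 3 * σ} ∩ E := by
    ext; simp only [Set.mem_inter_iff]; tauto
  have e2 : (B ∩ E) \ {ω | |M ω| ≤ 3 * σ} = (B \ {ω | |M ω| ≤ 3 * σ}) ∩ E := by
    ext; simp only [Set.mem_inter_iff, Set.mem_sdiff]; tauto
  rw [e1, e2] at h4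
  rw [← h3, ← h4, mul_add]
  exact add_le_add h1 h2

/-- `exp(-1_E)` is affine in `1_E` with slope `-(1 - 1/e)`, and `1 - 1/e ≥ 3/5`; then `1 - y ≤
exp(-y)`. -/
theorem condLIntegralLe_exp_neg_indicator {μ : Measure Ω} [IsProbabilityMeasure μ]
    {E : Set Ω} (hE : MeasurableSet E) {q : ℝ} (hq : 0 ≤ q)
    (h : ∀ B, MeasurableSet[m] B → q * μ.real B ≤ μ.real (B ∩ E)) :
    CondLIntegralLe μ m
      (fun ω => ENNReal.ofReal (Real.exp (-(E.indicator (fun _ => (1 : ℝ)) ω))))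
      (ENNReal.ofReal (Real.exp (-(3 / 5 * q)))) := by
  have hval : ∀ ω, Real.exp (-(E.indicator (fun _ => (1 : ℝ)) ω))
      = 1 - (1 - Real.exp (-1)) * E.indicator (fun _ => (1 : ℝ)) ω := fun ω => by
    by_cases hω : ω ∈ E <;> simp [hω]
  have hindE : Integrable (E.indicator fun _ => (1 : ℝ)) μ :=
    (integrable_const _).indicator hE
  have hint : Integrable (fun ω => 1 - (1 - Real.exp (-1)) *
      E.indicator (fun _ => (1 : ℝ)) ω) μ := (integrable_const _).sub (hindE.const_mul _)
  refine condLIntegralLe_ofReal (Real.exp_pos _).le (by simpa only [hval] using hint)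
    (fun ω => (Real.exp_pos _).le) fun B hB => ?_
  simp only [hval]
  rw [integral_sub (integrable_const _).integrableOn (hindE.const_mul _).integrableOn,
    integral_const_mul, setIntegral_indicator hE]
  simp only [integral_const, MeasurableSet.univ, measureReal_restrict_apply, Set.univ_inter,
      smul_eq_mul, mul_one]
  have h1 := h B hB
  have h2 : Real.exp (-1) ≤ 2 / 5 := by
    rw [Real.exp_neg, inv_le_comm₀ (Real.exp_pos _) (by norm_num)]
    linarith [Real.exp_one_gt_d9]
  have h3 := Real.add_one_le_exp (-(3 / 5 * q))
  have h4 : 0 ≤ μ.real B := measureReal_nonneg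
  have h5 : 3 / 5 * (q * μ.real B) ≤ (1 - Real.exp (-1)) * μ.real (B ∩ E) :=
    mul_le_mul (by linarith) h1 (by positivity) (by linarith)
  nlinarith

/-- The linear term averages out for a centred variable, so this is a one-line route to a
sub-Gaussian moment generating function. -/
theorem exp_le_add_exp_sq (s : ℝ) : Real.exp s ≤ s + Real.exp (s ^ 2) := by
  have h1 := Real.add_one_le_exp (s ^ 2)
  rcases le_or_gt |s| 1 with h | h
  · have := (abs_le.1 (Real.abs_exp_sub_one_sub_id_le h)).2
    linarith
  · rcases lt_abs.1 h with h | h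
    · have := Real.exp_le_exp.2 (show s ≤ s ^ 2 by nlinarith)
      linarith
    · have := Real.exp_le_one_iff.2 (show s ≤ 0 by linarith)
      nlinarith

theorem bernoulli_mgf_le {p : ℝ} (hp0 : 0 ≤ p) (hp1 : p ≤ 1) (s : ℝ) :
    p * Real.exp ((1 - p) * s) + (1 - p) * Real.exp ((0 - p) * s) ≤ Real.exp (s ^ 2) := by
  have h1 := exp_le_add_exp_sq ((1 - p) * s)
  have h2 := exp_le_add_exp_sq ((0 - p) * s)
  have h3 : Real.exp (((1 - p) * s) ^ 2) ≤ Real.exp (s ^ 2) := by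
    refine Real.exp_le_exp.2 ?_
    rw [mul_pow]
    exact mul_le_of_le_one_left (sq_nonneg s) (by nlinarith)
  have h4 : Real.exp (((0 - p) * s) ^ 2) ≤ Real.exp (s ^ 2) := by
    refine Real.exp_le_exp.2 ?_
    rw [mul_pow]
    exact mul_le_of_le_one_left (sq_nonneg s) (by nlinarith)
  nlinarith [mul_le_mul_of_nonneg_left (h1.trans (add_le_add_right h3 _)) hp0,
    mul_le_mul_of_nonneg_left (h2.trans (add_le_add_right h4 _)) (sub_nonneg.2 hp1)]

/-- The real-valued indicator of a Boolean random variable. -/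
def boolInd (b : Bool) : ℝ := if b then 1 else 0

/-- Subtracting the compensator `Y²` makes the exponential of the transform a supermartingale step
even for unbounded `Y`. Independence lets `ξ` be averaged with `Y` frozen, which reduces to
`bernoulli_mgf_le`. -/
theorem condLIntegralLe_bernoulli {μ : Measure Ω} [IsProbabilityMeasure μ] (hm : m ≤ m0)
    {ξ : Ω → Bool} (hξ : Measurable ξ) {p : ℝ} (hp0 : 0 ≤ p) (hp1 : p ≤ 1)
    (hp : μ.real {ω | ξ ω = true} = p) (hind : Indep (sigmaOf ξ) m μ) {Y : Ω → ℝ}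
    (hY : Measurable[m] Y) :
    CondLIntegralLe μ m
      (fun ω => ENNReal.ofReal (Real.exp ((boolInd (ξ ω) - p) * Y ω - Y ω ^ 2)))
      (ENNReal.ofReal (Real.exp 0)) := by
  intro B hB
  have hY0 : Measurable Y := hY.mono hm le_rfl
  have key : ∀ b : Bool, ∫⁻ ω in B, ENNReal.ofReal (Real.exp ((boolInd b - p) * Y ω - Y ω ^ 2)) *
      {ω | ξ ω = b}.indicator (fun _ => (1 : ENNReal)) ω ∂μ = μ {ω | ξ ω = b} *
      ∫⁻ ω in B, ENNReal.ofReal (Real.exp ((boolInd b - p) * Y ω - Y ω ^ 2)) ∂μ := by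
    intro b
    have hbm : MeasurableSet[sigmaOf ξ] {ω | ξ ω = b} := ⟨{b}, trivial, rfl⟩
    have hf : Measurable[m] fun ω =>
        ENNReal.ofReal (Real.exp ((boolInd b - p) * Y ω - Y ω ^ 2)) := by
      have : Measurable fun y : ℝ =>
          ENNReal.ofReal (Real.exp ((boolInd b - p) * y - y ^ 2)) := by fun_prop
      exact this.comp hY
    have h1 := lintegral_mul_indicator_eq_lintegral_mul_lintegral_indicator (μ := μ) hm 1
      (hξ.comap_le _ hbm) (by
        rw [Indep_iff] at hind
        rw [IndepSets_iff]
        rintro t1 t2 ht1 rfl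
        rw [Set.inter_comm, hind _ _ hbm ht1, mul_comm]) (hf.indicator hB)
    rw [lintegral_indicator (hm _ hB), lintegral_indicator_const (hξ.comap_le _ hbm),
      one_mul] at h1
    rw [mul_comm, ← h1, ← lintegral_indicator (hm _ hB)]
    refine lintegral_congr fun ω => ?_
    by_cases hω : ω ∈ B <;> simp [hω]
  have hsplit : ∀ ω, ENNReal.ofReal (Real.exp ((boolInd (ξ ω) - p) * Y ω - Y ω ^ 2))
      = ENNReal.ofReal (Real.exp ((boolInd true - p) * Y ω - Y ω ^ 2)) *
        {ω | ξ ω = true}.indicator (fun _ => (1 : ENNReal)) ω +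
        ENNReal.ofReal (Real.exp ((boolInd false - p) * Y ω - Y ω ^ 2)) *
        {ω | ξ ω = false}.indicator (fun _ => (1 : ENNReal)) ω := fun ω => by
    cases h : ξ ω <;> simp [h]
  have hmeas : ∀ b : Bool, Measurable fun ω =>
      ENNReal.ofReal (Real.exp ((boolInd b - p) * Y ω - Y ω ^ 2)) := fun b => by fun_prop
  have hset : ∀ b : Bool, MeasurableSet {ω | ξ ω = b} := fun b => hξ (measurableSet_singleton b)
  have h1 : μ {ω | ξ ω = true} = ENNReal.ofReal p := by
    rw [← hp, Measure.real, ENNReal.ofReal_toReal (measure_ne_top _ _)]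
  have h0 : μ {ω | ξ ω = false} = ENNReal.ofReal (1 - p) := by
    have hc : {ω | ξ ω = false} = {ω | ξ ω = true}ᶜ := by ext; simp
    rw [hc, ← hp, ← probReal_compl_eq_one_sub (hset true), Measure.real,
      ENNReal.ofReal_toReal (measure_ne_top _ _)]
  have hmul : Measurable fun ω => ENNReal.ofReal (Real.exp ((boolInd true - p) * Y ω - Y ω ^ 2)) *
      {ω | ξ ω = true}.indicator (fun _ => (1 : ENNReal)) ω :=
    (hmeas true).mul (measurable_const.indicator (hset true))
  simp only [hsplit]
  rw [lintegral_add_left hmul,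
    key, key, h1, h0, ← lintegral_const_mul _ (hmeas true),
    ← lintegral_const_mul _ (hmeas false), ← lintegral_add_left ((hmeas true).const_mul _),
    Real.exp_zero, ENNReal.ofReal_one, one_mul]
  calc _ ≤ ∫⁻ _ in B, 1 ∂μ := by
        refine lintegral_mono fun ω => ?_
        rw [← ENNReal.ofReal_mul hp0, ← ENNReal.ofReal_mul (sub_nonneg.2 hp1),
          ← ENNReal.ofReal_add (by positivity)
            (mul_nonneg (sub_nonneg.2 hp1) (Real.exp_pos _).le), ENNReal.ofReal_le_one]
        have := bernoulli_mgf_le hp0 hp1 (Y ω)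
        simp only [boolInd, if_true, Bool.false_eq_true, if_false, Real.exp_sub]
        rw [← mul_div_assoc, ← mul_div_assoc, ← add_div, div_le_one (Real.exp_pos _)]
        exact this
    _ = μ B := by simp

/-- A self-normalized deviation bound for a Bernoulli martingale transform. -/
theorem measureReal_bernoulli_sum_le {μ : Measure Ω} [IsProbabilityMeasure μ]
    (G : ℕ → MeasurableSpace Ω) (ξ : ℕ → Ω → Bool) (Y : ℕ → Ω → ℝ) {p : ℝ} (T : ℕ)
    (hp0 : 0 ≤ p) (hp1 : p ≤ 1) (hG : ∀ t < T, G t ≤ m0) (hξ : ∀ t < T, Measurable (ξ t))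
    (hp : ∀ t < T, μ.real {ω | ξ t ω = true} = p)
    (hind : ∀ t < T, Indep (sigmaOf (ξ t)) (G t) μ)
    (hY : ∀ t < T, ∀ s ≤ t, Measurable[G t] (Y s))
    (hξG : ∀ t < T, ∀ s < t, Measurable[G t] (ξ s)) {r V : ℝ} (hr : 0 ≤ r) (hV : 0 < V) :
    μ.real {ω | r ≤ ∑ t ∈ Finset.range T, (boolInd (ξ t ω) - p) * Y t ω ∧
      ∑ t ∈ Finset.range T, Y t ω ^ 2 ≤ V} ≤ Real.exp (-(r ^ 2 / (4 * V))) := by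
  -- The maximiser of the exponent `θr - θ²V`.
  set θ := r / (2 * V) with hθ
  have hθ0 : 0 ≤ θ := by positivity
  have hb : Measurable boolInd := measurable_of_finite _
  have hF : Measurable fun z : Bool × ℝ => (boolInd z.1 - p) * (θ * z.2) - (θ * z.2) ^ 2 := by
    have : Measurable fun z : Bool × ℝ => boolInd z.1 := hb.comp measurable_fst
    fun_prop
  have h := measureReal_le_sum_le_exp (μ := μ) G
    (fun t ω => (boolInd (ξ t ω) - p) * (θ * Y t ω) - (θ * Y t ω) ^ 2) 0 T hG
    (fun t ht => hF.comp ((hξ t ht).prodMk ((hY t ht t le_rfl).mono (hG t ht) le_rfl)))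
    (fun t ht s hs => hF.comp
      (Measurable.prodMk (m := G t) (hξG t ht s hs) (hY t ht s hs.le)))
    (fun t ht => condLIntegralLe_bernoulli (hG t ht) (hξ t ht) hp0 hp1 (hp t ht) (hind t ht)
      (Measurable.const_mul (m := G t) (hY t ht t le_rfl) θ)) (θ * r - θ ^ 2 * V)
  have hexp : (T : ℝ) * 0 - (θ * r - θ ^ 2 * V) = -(r ^ 2 / (4 * V)) := by
    rw [hθ]; field_simp; ring
  rw [hexp] at h
  refine (measureReal_mono ?_).trans h
  rintro ω ⟨h1, h2⟩
  have e : ∑ t ∈ Finset.range T, ((boolInd (ξ t ω) - p) * (θ * Y t ω) - (θ * Y t ω) ^ 2)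
      = θ * ∑ t ∈ Finset.range T, (boolInd (ξ t ω) - p) * Y t ω -
        θ ^ 2 * ∑ t ∈ Finset.range T, Y t ω ^ 2 := by
    rw [Finset.sum_sub_distrib, Finset.mul_sum, Finset.mul_sum]
    congr 1 <;> exact Finset.sum_congr rfl fun _ _ => by ring
  simp only [Set.mem_ofPred_eq]
  rw [e]
  exact sub_le_sub (mul_le_mul_of_nonneg_left h1 hθ0)
    (mul_le_mul_of_nonneg_left h2 (sq_nonneg θ))

end ConditionalEstimates

/-! ### Unrolling the dynamics into innovations -/

section Innovations

variable {Ω : Type*} {n : ℕ}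

/-- The innovations `x₀, x₁ - L x₀, x₂ - L x₁, …`. -/
def innov (L : Vec n →L[ℝ] Vec n) (x : ℕ → Ω → Vec n) : ℕ → Ω → Vec n
  | 0 => x 0
  | s + 1 => fun ω => x (s + 1) ω - L (x s ω)

/-- The σ-algebra of the states strictly before time `s`. -/
abbrev histBefore (x : ℕ → Ω → Vec n) : ℕ → MeasurableSpace Ω
  | 0 => ⊥
  | s + 1 => hist x s

theorem state_eq_sum_innov (L : Vec n →L[ℝ] Vec n) (x : ℕ → Ω → Vec n) (t : ℕ) (ω : Ω) :
    x t ω = ∑ k ∈ Finset.range (t + 1), (L ^ k) (innov L x (t - k) ω) := by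
  induction t with
  | zero => simp [innov]
  | succ t ih =>
    rw [Finset.sum_range_succ']
    simp only [Nat.add_sub_add_right, pow_succ', mul_apply_eq_comp, pow_zero,
      one_apply_eq_self, Nat.sub_zero]
    rw [← map_sum, ← ih]
    simp [innov]

theorem measurable_hist (x : ℕ → Ω → Vec n) {s t : ℕ} (h : s ≤ t) :
    Measurable[hist x t] (x s) :=
  (comap_measurable (x s)).mono (le_iSup₂_of_le s h le_rfl) le_rfl

theorem measurable_innov_hist (L : Vec n →L[ℝ] Vec n) (x : ℕ → Ω → Vec n) {s t : ℕ}
    (h : s ≤ t) : Measurable[hist x t] (innov L x s) := by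
  cases s with
  | zero => exact measurable_hist x h
  | succ s =>
    exact Measurable.sub (m := hist x t) (measurable_hist x h)
      (L.continuous.measurable.comp (measurable_hist x (by omega)))

theorem measurable_innov_histBefore (L : Vec n →L[ℝ] Vec n) (x : ℕ → Ω → Vec n) {s t : ℕ}
    (h : s < t) : Measurable[histBefore x t] (innov L x s) := by
  cases t with
  | zero => omega
  | succ t => exact measurable_innov_hist L x (by omega)

theorem hist_le [m0 : MeasurableSpace Ω] {x : ℕ → Ω → Vec n} {t : ℕ}
    (hx : ∀ s ≤ t, Measurable (x s)) : hist x t ≤ m0 :=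
  iSup₂_le fun s hs => (hx s hs).comap_le

theorem histBefore_le [m0 : MeasurableSpace Ω] {x : ℕ → Ω → Vec n} {t : ℕ}
    (hx : ∀ s < t, Measurable (x s)) : histBefore x t ≤ m0 := by
  cases t with
  | zero => exact bot_le
  | succ t => exact hist_le fun s hs => hx s (by omega)

/-- Moving `L ^ k` to the other side by the adjoint gives a test vector in the unit ball that
depends on the lag `k` only, so the sub-Gaussian hypothesis applies to it at every time. -/
theorem exists_directions (L : Vec n →L[ℝ] Vec n) {d : Vec n} (hd : ‖d‖ ≤ 1) :
    ∃ u : ℕ → Vec n, (∀ k, ‖u k‖ ≤ 1) ∧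
      ∀ k y, inner ℝ d ((L ^ k) y) = ‖L ^ k‖ * inner ℝ (u k) y := by
  have hb : ∀ k, ‖(L ^ k).adjoint d‖ ≤ ‖L ^ k‖ := fun k => by
    refine ((L ^ k).adjoint.le_opNorm d).trans ?_
    rw [LinearIsometryEquiv.norm_map]
    exact mul_le_of_le_one_right (norm_nonneg _) hd
  refine ⟨fun k => ‖L ^ k‖⁻¹ • (L ^ k).adjoint d, fun k => ?_, fun k y => ?_⟩
  · rw [norm_smul, norm_inv, norm_norm]
    exact inv_mul_le_one_of_le₀ (hb k) (norm_nonneg _)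
  · rw [← ContinuousLinearMap.adjoint_inner_left, real_inner_smul_left, ← mul_assoc]
    rcases eq_or_ne ‖L ^ k‖ 0 with h | h
    · have : (L ^ k).adjoint d = 0 := norm_le_zero_iff.1 (h ▸ hb k)
      simp [this]
    · rw [mul_inv_cancel₀ h, one_mul]

/-- A Young-type convolution inequality: weighted Cauchy–Schwarz in the lag `k`, then the triangular
sum over `(k, t - k)` is enlarged to a square. -/
theorem sum_sq_convolution_le {α : ℕ → ℝ} (hα : ∀ k, 0 ≤ α k) (a : ℕ → ℕ → ℝ) (T : ℕ) :
    ∑ t ∈ Finset.range T, (∑ k ∈ Finset.range (t + 1), α k * a k (t - k)) ^ 2 ≤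
      (∑ k ∈ Finset.range T, α k) *
        ∑ s ∈ Finset.range T, ∑ k ∈ Finset.range T, α k * a k s ^ 2 := by
  have h0 : ∀ k s, 0 ≤ α k * a k s ^ 2 := fun k s => mul_nonneg (hα k) (sq_nonneg _)
  calc ∑ t ∈ Finset.range T, (∑ k ∈ Finset.range (t + 1), α k * a k (t - k)) ^ 2
      ≤ ∑ t ∈ Finset.range T, (∑ k ∈ Finset.range T, α k) *
          ∑ k ∈ Finset.range (t + 1), α k * a k (t - k) ^ 2 := by
        refine Finset.sum_le_sum fun t ht => ?_
        refine (Finset.sum_sq_le_sum_mul_sum_of_sq_le_mul _ (fun k _ => hα k)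
          (fun k _ => h0 k (t - k)) fun k _ => le_of_eq (by ring)).trans ?_
        refine mul_le_mul_of_nonneg_right ?_ (Finset.sum_nonneg fun k _ => h0 _ _)
        refine Finset.sum_le_sum_of_subset_of_nonneg ?_ fun k _ _ => hα k
        have := Finset.mem_range.1 ht
        exact Finset.range_mono (by omega)
    _ = (∑ k ∈ Finset.range T, α k) *
          ∑ t ∈ Finset.range T, ∑ k ∈ Finset.range (t + 1), α k * a k (t - k) ^ 2 := by
        rw [Finset.mul_sum]
    _ ≤ _ := by
        refine mul_le_mul_of_nonneg_left ?_ (Finset.sum_nonneg fun k _ => hα k)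
        rw [Finset.sum_comm (s := Finset.range T) (t := Finset.range T)]
        simp only [Finset.range_eq_Ico]
        rw [← Finset.sum_Ico_Ico_comm]
        refine Finset.sum_le_sum fun k _ => ?_
        rw [Finset.sum_Ico_eq_sum_range]
        simp only [add_tsub_cancel_left]
        rw [← Finset.range_eq_Ico]
        exact Finset.sum_le_sum_of_subset_of_nonneg (Finset.range_mono (by omega))
          fun s _ _ => h0 k s

theorem sum_inner_sq_le (L : Vec n →L[ℝ] Vec n) (x : ℕ → Ω → Vec n) {d : Vec n} {u : ℕ → Vec n}
    (hu : ∀ k y, inner ℝ d ((L ^ k) y) = ‖L ^ k‖ * inner ℝ (u k) y) (T : ℕ) (ω : Ω) :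
    ∑ t ∈ Finset.range T, (inner ℝ d (x t ω)) ^ 2 ≤ (∑ k ∈ Finset.range T, ‖L ^ k‖) *
      ∑ s ∈ Finset.range T, ∑ k ∈ Finset.range T,
        ‖L ^ k‖ * (inner ℝ (u k) (innov L x s ω)) ^ 2 := by
  refine le_trans (le_of_eq ?_) (sum_sq_convolution_le (α := fun k => ‖L ^ k‖)
    (fun k => norm_nonneg _) (fun k s => inner ℝ (u k) (innov L x s ω)) T)
  refine Finset.sum_congr rfl fun t _ => ?_
  rw [state_eq_sum_innov L x t ω, inner_sum]
  simp only [hu]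

end Innovations

/-! ### High-probability bounds in a fixed direction -/

section StateBounds

variable {Ω : Type*} [m0 : MeasurableSpace Ω] {n : ℕ}

/-- With overwhelming probability the energy of the states in a fixed direction grows at most
linearly in time. -/
theorem measureReal_energy_le {μ : Measure Ω} [IsProbabilityMeasure μ] (L : Vec n →L[ℝ] Vec n)
    (x : ℕ → Ω → Vec n) (T : ℕ) {σ S : ℝ} (hσ : 0 < σ) (hx : ∀ t < T, Measurable (x t))
    (hψ : ∀ s < T, ∀ u : Vec n, ‖u‖ ≤ 1 → CondLIntegralLe μ (histBefore x s)
      (fun ω => ENNReal.ofReal (Real.exp ((inner ℝ u (innov L x s ω)) ^ 2 / σ ^ 2)))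
      (ENNReal.ofReal 2))
    (hS : ∑ k ∈ Finset.range T, ‖L ^ k‖ ≤ S) {d : Vec n} (hd : ‖d‖ ≤ 1) :
    μ.real {ω | 2 * S ^ 2 * σ ^ 2 * T < ∑ t ∈ Finset.range T, (inner ℝ d (x t ω)) ^ 2} ≤
      Real.exp (-T) := by
  obtain ⟨u, hu1, hu⟩ := exists_directions L hd
  have hen := sum_inner_sq_le L x hu T
  set α : ℕ → ℝ := fun k => ‖L ^ k‖ with hα
  have hα0 : ∀ k, 0 ≤ α k := fun k => norm_nonneg _
  set ST := ∑ k ∈ Finset.range T, α k with hST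
  have hST0 : 0 ≤ ST := Finset.sum_nonneg fun k _ => hα0 k
  have hσ2 : 0 < σ ^ 2 := by positivity
  rcases hST0.eq_or_lt with h0 | hpos
  · have : {ω | 2 * S ^ 2 * σ ^ 2 * T < ∑ t ∈ Finset.range T, (inner ℝ d (x t ω)) ^ 2} = ∅ := by
      refine Set.eq_empty_of_forall_notMem fun ω hω => ?_
      have h1 := hen ω
      rw [← h0, zero_mul] at h1
      have : 0 ≤ 2 * S ^ 2 * σ ^ 2 * T := by positivity
      exact absurd (lt_of_lt_of_le hω h1) (not_lt.2 this)
    rw [this, measureReal_empty]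
    exact (Real.exp_pos _).le
  have hxi : ∀ s < T, Measurable (innov L x s) := fun s hs =>
    (measurable_innov_hist L x le_rfl).mono (hist_le fun r hr => hx r (by omega)) le_rfl
  have hin : ∀ v : Vec n, Measurable fun y : Vec n => inner ℝ v y := fun v => by fun_prop
  have hw1 : ∑ k ∈ Finset.range T, α k / ST = 1 := by
    rw [← Finset.sum_div, div_self hpos.ne']
  have hw0 : ∀ k ∈ Finset.range T, 0 ≤ α k / ST := fun k _ => div_nonneg (hα0 k) hST0
  have hYm : Measurable fun y : Vec n =>
      ∑ k ∈ Finset.range T, α k / ST * ((inner ℝ (u k) y) ^ 2 / σ ^ 2) := by fun_prop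
  -- With the weights `α k / ST`, Jensen's inequality keeps each conditional exponential moment at
  -- most `2`, so level `2T` is exceeded with probability at most `exp(T log 2 - 2T)`.
  have h := measureReal_le_sum_le_exp (μ := μ) (histBefore x)
    (fun s ω => ∑ k ∈ Finset.range T,
      α k / ST * ((inner ℝ (u k) (innov L x s ω)) ^ 2 / σ ^ 2)) (Real.log 2) T
    (fun t ht => histBefore_le fun s hs => hx s (by omega))
    (fun t ht => hYm.comp (hxi t ht))
    (fun t ht s hs => hYm.comp (measurable_innov_histBefore L x hs))
    (fun s hs => by
      rw [Real.exp_log (by norm_num)]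
      refine (CondLIntegralLe.finset_sum (Finset.range T) (fun k => α k / ST)
        (fun k ω => Real.exp ((inner ℝ (u k) (innov L x s ω)) ^ 2 / σ ^ 2)) hw0 hw1
        (fun k _ => ?_) (fun k ω => (Real.exp_pos _).le)
        (fun k _ => hψ s hs (u k) (hu1 k))).mono_fun fun ω => ?_
      · have := (hin (u k)).comp (hxi s hs)
        exact Real.measurable_exp.comp ((this.pow_const 2).div_const _)
      · refine ENNReal.ofReal_le_ofReal ?_
        have := convexOn_exp.map_sum_le (t := Finset.range T) (w := fun k => α k / ST)
          (p := fun k => (inner ℝ (u k) (innov L x s ω)) ^ 2 / σ ^ 2) hw0 hw1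
          (fun _ _ => Set.mem_univ _)
        simpa only [smul_eq_mul] using this) (2 * T)
  refine (measureReal_mono fun ω hω => ?_).trans (h.trans (Real.exp_le_exp.2 ?_))
  · have h1 := hen ω
    have h2 : ∑ s ∈ Finset.range T, ∑ k ∈ Finset.range T,
        α k / ST * ((inner ℝ (u k) (innov L x s ω)) ^ 2 / σ ^ 2)
        = (∑ s ∈ Finset.range T, ∑ k ∈ Finset.range T,
          α k * (inner ℝ (u k) (innov L x s ω)) ^ 2) / (ST * σ ^ 2) := by
      simp only [Finset.sum_div]
      refine Finset.sum_congr rfl fun s _ => Finset.sum_congr rfl fun k _ => ?_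
      field_simp
    simp only [Set.mem_ofPred_eq] at hω ⊢
    rw [h2, le_div_iff₀ (by positivity)]
    refine le_of_mul_le_mul_left (le_trans ?_ (hω.le.trans h1)) hpos
    have : ST ^ 2 ≤ S ^ 2 := pow_le_pow_left₀ hST0 hS 2
    calc ST * (2 * T * (ST * σ ^ 2)) = 2 * ST ^ 2 * σ ^ 2 * T := by ring
      _ ≤ 2 * S ^ 2 * σ ^ 2 * T := by gcongr
  · have := Real.log_two_lt_d9
    have : (T : ℝ) * Real.log 2 ≤ T * 1 := by gcongr; linarith
    linarith

/-- With overwhelming probability the states are excited linearly often in a fixed direction. -/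
theorem measureReal_sum_abs_inner_lt {μ : Measure Ω} [IsProbabilityMeasure μ]
    (L : Vec n →L[ℝ] Vec n) (x : ℕ → Ω → Vec n) (T : ℕ) {σ l : ℝ} (hσ : 0 < σ) (hl : 0 < l)
    (hlσ : l ≤ 2 * σ) (hx : ∀ t ≤ T, Measurable (x t)) {d : Vec n}
    (hψ : ∀ s < T, CondLIntegralLe μ (hist x s)
      (fun ω => ENNReal.ofReal (Real.exp ((inner ℝ d (innov L x (s + 1) ω)) ^ 2 / σ ^ 2)))
      (ENNReal.ofReal 2))
    (hexc : ∀ t < T, ∀ B, MeasurableSet[hist x t] B →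
      l ^ 2 * μ.real B ≤ ∫ ω in B, (inner ℝ d (x (t + 1) ω)) ^ 2 ∂μ) :
    μ.real {ω | ∑ t ∈ Finset.range T, |inner ℝ d (x (t + 1) ω)| <
      l / 2 * (l ^ 4 / (1328 * σ ^ 4) * T / 2)} ≤
      Real.exp (-(l ^ 4 / (1328 * σ ^ 4) * T / 10)) := by
  set q := l ^ 4 / (1328 * σ ^ 4) with hq
  have hq0 : 0 ≤ q := by positivity
  have hF : ∀ t < T, hist x t ≤ m0 := fun t ht => hist_le fun s hs => hx s (by omega)
  have hin : Measurable fun y : Vec n => inner ℝ d y := by fun_prop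
  set E : ℕ → Set Ω := fun t => {ω | l / 2 ≤ |inner ℝ d (x (t + 1) ω)|} with hE
  have hEm : ∀ t < T, MeasurableSet (E t) := fun t ht =>
    measurableSet_half_le (hin.comp (hx (t + 1) (by omega))) l
  have hEad : ∀ t < T, ∀ s < t, MeasurableSet[hist x t] (E s) := fun t ht s hs =>
    @measurableSet_half_le Ω (hist x t) _ (hin.comp (measurable_hist x (by omega))) l
  -- Lower-tail count of the events `E t`: half of the guaranteed rate `q` is demanded, and `3/5 -
  -- 1/2 = 1/10` is left in the exponent.
  have h := measureReal_le_sum_le_exp (μ := μ) (hist x)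
    (fun t ω => -((E t).indicator (fun _ => (1 : ℝ)) ω)) (-(3 / 5 * q)) T hF
    (fun t ht => (measurable_const.indicator (hEm t ht)).neg)
    (fun t ht s hs => Measurable.neg (m := hist x t)
      (Measurable.indicator (m := hist x t) measurable_const (hEad t ht s hs)))
    (fun t ht => condLIntegralLe_exp_neg_indicator (hEm t ht) hq0 fun B hB =>
      smallBall_measure (hF t ht) (X := fun ω => inner ℝ d (x (t + 1) ω))
        (M := fun ω => inner ℝ d (L (x t ω)))
        (Z := fun ω => inner ℝ d (innov L x (t + 1) ω)) hσ hl hlσ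
        ((hin.comp L.continuous.measurable).comp (measurable_hist x le_rfl))
        (hin.comp ((measurable_innov_hist L x le_rfl).mono
          (hist_le fun s hs => hx s (by omega)) le_rfl))
        (fun ω => by simp [innov, inner_sub_right]) (hψ t ht) (hexc t ht) hB) (-(q * T / 2))
  refine (measureReal_mono fun ω hω => ?_).trans (h.trans (Real.exp_le_exp.2 ?_))
  · simp only [Set.mem_ofPred_eq] at hω ⊢
    rw [Finset.sum_neg_distrib, neg_le_neg_iff]
    refine le_of_mul_le_mul_left (le_trans ?_ hω.le) (half_pos hl)
    rw [Finset.mul_sum]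
    refine Finset.sum_le_sum fun t _ => ?_
    by_cases ht : ω ∈ E t
    · rw [Set.indicator_of_mem ht, mul_one]; exact ht
    · rw [Set.indicator_of_notMem ht, mul_zero]; exact abs_nonneg _
  · apply le_of_eq; ring

/-- The sign-weighted absolute deviations in a fixed direction are large, with overwhelming
probability. -/
theorem measureReal_signed_sum_lt {μ : Measure Ω} [IsProbabilityMeasure μ]
    (L : Vec n →L[ℝ] Vec n) (x : ℕ → Ω → Vec n) (T : ℕ) {σ l S p : ℝ} (hσ : 0 < σ)
    (hl : 0 < l) (hlσ : l ≤ 2 * σ) (hS0 : 0 < S) (hp0 : 0 ≤ p) (hp1 : p < 1 / 2)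
    (hx : ∀ t < T + 1, Measurable (x t)) {d : Vec n} (hd : ‖d‖ ≤ 1)
    (hψ : ∀ s < T + 1, ∀ u : Vec n, ‖u‖ ≤ 1 → CondLIntegralLe μ (histBefore x s)
      (fun ω => ENNReal.ofReal (Real.exp ((inner ℝ u (innov L x s ω)) ^ 2 / σ ^ 2)))
      (ENNReal.ofReal 2))
    (hS : ∑ k ∈ Finset.range (T + 1), ‖L ^ k‖ ≤ S)
    (hexc : ∀ t < T, ∀ B, MeasurableSet[hist x t] B →
      l ^ 2 * μ.real B ≤ ∫ ω in B, (inner ℝ d (x (t + 1) ω)) ^ 2 ∂μ)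
    (ξ : ℕ → Ω → Bool) (hξ : ∀ t < T + 1, Measurable (ξ t))
    (hp : ∀ t < T + 1, μ.real {ω | ξ t ω = true} = p)
    (hind : ∀ t < T + 1,
      Indep (sigmaOf (ξ t)) (hist x t ⊔ ⨆ s : ℕ, ⨆ _ : s < t, sigmaOf (ξ s)) μ)
    {r : ℝ} (hr : 0 ≤ r) :
    μ.real {ω | ∑ t ∈ Finset.range (T + 1), (1 - 2 * boolInd (ξ t ω)) * |inner ℝ d (x t ω)| <
      (1 - 2 * p) * (l / 2 * (l ^ 4 / (1328 * σ ^ 4) * T / 2)) - 2 * r} ≤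
      Real.exp (-((T + 1 : ℕ) : ℝ)) + Real.exp (-(l ^ 4 / (1328 * σ ^ 4) * T / 10)) +
        Real.exp (-(r ^ 2 / (4 * (2 * S ^ 2 * σ ^ 2 * (T + 1 : ℕ))))) := by
  have hin : Measurable fun y : Vec n => |inner ℝ d y| := by fun_prop
  have h1 := measureReal_energy_le L x (T + 1) hσ hx hψ hS hd
  have h2 := measureReal_sum_abs_inner_lt L x T hσ hl hlσ (fun t ht => hx t (by omega))
    (d := d) (fun s hs => hψ (s + 1) (by omega) d hd) hexc
  have hG : ∀ t < T + 1, hist x t ⊔ ⨆ s : ℕ, ⨆ _ : s < t, sigmaOf (ξ s) ≤ m0 := fun t ht =>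
    sup_le (hist_le fun s hs => hx s (by omega))
      (iSup₂_le fun s hs => (hξ s (by omega)).comap_le)
  have h3 := measureReal_bernoulli_sum_le (μ := μ)
    (fun t => hist x t ⊔ ⨆ s : ℕ, ⨆ _ : s < t, sigmaOf (ξ s)) ξ
    (fun t ω => |inner ℝ d (x t ω)|) (T + 1) hp0 (by linarith) hG hξ hp hind
    (fun t ht s hs => (hin.comp (measurable_hist x hs)).mono le_sup_left le_rfl)
    (fun t ht s hs => (comap_measurable (ξ s)).mono
      ((le_iSup₂_of_le (f := fun s (_ : s < t) => sigmaOf (ξ s)) s hs le_rfl).trans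
        le_sup_right) le_rfl) hr
    (V := 2 * S ^ 2 * σ ^ 2 * (T + 1 : ℕ)) (by positivity)
  refine (measureReal_mono ?_).trans ((measureReal_union_le _ _).trans
    (add_le_add ((measureReal_union_le _ _).trans (add_le_add h1 h2)) h3))
  intro ω hω
  simp only [Set.mem_union, Set.mem_ofPred_eq, sq_abs] at hω ⊢
  by_contra hcon
  push Not at hcon
  obtain ⟨⟨hc1, hc2⟩, hc3⟩ := hcon
  have hD : ∑ t ∈ Finset.range (T + 1), (boolInd (ξ t ω) - p) * |inner ℝ d (x t ω)| < r := by
    by_contra hD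
    exact absurd (hc3 (not_lt.1 hD)) (not_lt.2 hc1)
  have e : ∑ t ∈ Finset.range (T + 1), (1 - 2 * boolInd (ξ t ω)) * |inner ℝ d (x t ω)|
      = (1 - 2 * p) * ∑ t ∈ Finset.range (T + 1), |inner ℝ d (x t ω)| -
        2 * ∑ t ∈ Finset.range (T + 1), (boolInd (ξ t ω) - p) * |inner ℝ d (x t ω)| := by
    rw [Finset.mul_sum, Finset.mul_sum, ← Finset.sum_sub_distrib]
    exact Finset.sum_congr rfl fun _ _ => by ring
  -- Excitation says nothing about `x 0`, so its nonnegative term is discarded; this is why the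
  -- horizon is `T + 1` but the count runs over `T` times.
  have h4 : ∑ t ∈ Finset.range T, |inner ℝ d (x (t + 1) ω)| ≤
      ∑ t ∈ Finset.range (T + 1), |inner ℝ d (x t ω)| := by
    rw [Finset.sum_range_succ']
    linarith [abs_nonneg (inner ℝ d (x 0 ω) : ℝ)]
  have h5 := mul_le_mul_of_nonneg_left (hc2.trans h4) (show 0 ≤ 1 - 2 * p by linarith)
  rw [e] at hω
  linarith

end StateBounds

/-! ### Calculus of the sub-Gaussian norm -/

section PsiTwo

variable {Ω : Type*} {m : MeasurableSpace Ω} [m0 : MeasurableSpace Ω] {n : ℕ}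

/-- The triangle inequality for the `ψ₂` norm in pointwise form, from convexity of the square and of
`exp`. No independence of the summands is involved. -/
theorem exp_sq_add_div_le {s t : ℝ} (hs : 0 < s) (ht : 0 < t) (a b : ℝ) :
    Real.exp ((a + b) ^ 2 / (s + t) ^ 2) ≤
      s / (s + t) * Real.exp (a ^ 2 / s ^ 2) + t / (s + t) * Real.exp (b ^ 2 / t ^ 2) := by
  have hst : 0 < s + t := by linarith
  have h1 : (a + b) ^ 2 / (s + t) ^ 2 ≤
      s / (s + t) * (a ^ 2 / s ^ 2) + t / (s + t) * (b ^ 2 / t ^ 2) := by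
    have e : s / (s + t) * (a ^ 2 / s ^ 2) + t / (s + t) * (b ^ 2 / t ^ 2) -
        (a + b) ^ 2 / (s + t) ^ 2 = (a * t - b * s) ^ 2 / (s * t * (s + t) ^ 2) := by
      field_simp; ring
    have : 0 ≤ (a * t - b * s) ^ 2 / (s * t * (s + t) ^ 2) := by positivity
    linarith
  have h2 := convexOn_exp.2 (Set.mem_univ (a ^ 2 / s ^ 2)) (Set.mem_univ (b ^ 2 / t ^ 2))
    (div_pos hs hst).le (div_pos ht hst).le (by field_simp)
  simp only [smul_eq_mul] at h2
  exact (Real.exp_le_exp.2 h1).trans h2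

theorem condLIntegralLe_exp_of_unit {μ : Measure Ω} {X : Ω → Vec n} {σ : ℝ}
    (h : ∀ u : Vec n, ‖u‖ = 1 → CondLIntegralLe μ m
      (fun ω => ENNReal.ofReal (Real.exp ((inner ℝ u (X ω)) ^ 2 / σ ^ 2))) (ENNReal.ofReal 2))
    (u : Vec n) (hu : ‖u‖ ≤ 1) : CondLIntegralLe μ m
      (fun ω => ENNReal.ofReal (Real.exp ((inner ℝ u (X ω)) ^ 2 / σ ^ 2)))
      (ENNReal.ofReal 2) := by
  rcases eq_or_ne u 0 with rfl | h0
  · intro B hB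
    simp only [inner_zero_left, ne_eq, OfNat.ofNat_ne_zero, not_false_eq_true, zero_pow, zero_div,
      Real.exp_zero, ENNReal.ofReal_one, lintegral_const, Measure.restrict_apply_univ]
    gcongr
    exact ENNReal.one_le_ofReal.2 (by norm_num)
  · have hn : ‖u‖ ≠ 0 := norm_ne_zero_iff.2 h0
    refine (h (‖u‖⁻¹ • u) (by rw [norm_smul, norm_inv, norm_norm, inv_mul_cancel₀ hn])).mono_fun
      fun ω => ENNReal.ofReal_le_ofReal (Real.exp_le_exp.2 ?_)
    rw [real_inner_smul_left, mul_pow]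
    have : 1 ≤ (‖u‖⁻¹) ^ 2 := one_le_pow₀ ((one_le_inv₀ (by positivity)).2 hu)
    gcongr
    exact le_mul_of_one_le_left (sq_nonneg _) this

theorem CondLIntegralLe.exp_mono {μ : Measure Ω} {Y : Ω → ℝ} {s t : ℝ} (hs : 0 < s)
    (hst : s ≤ t) {c : ENNReal}
    (h : CondLIntegralLe μ m (fun ω => ENNReal.ofReal (Real.exp (Y ω ^ 2 / s ^ 2))) c) :
    CondLIntegralLe μ m (fun ω => ENNReal.ofReal (Real.exp (Y ω ^ 2 / t ^ 2))) c :=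
  h.mono_fun fun ω => ENNReal.ofReal_le_ofReal (Real.exp_le_exp.2 (by gcongr))

theorem CondLIntegralLe.exp_add {μ : Measure Ω} {Y Z : Ω → ℝ} {s t : ℝ} (hs : 0 < s)
    (ht : 0 < t) (hY : Measurable Y) (hZ : Measurable Z) {c : ℝ}
    (h1 : CondLIntegralLe μ m (fun ω => ENNReal.ofReal (Real.exp (Y ω ^ 2 / s ^ 2)))
      (ENNReal.ofReal c))
    (h2 : CondLIntegralLe μ m (fun ω => ENNReal.ofReal (Real.exp (Z ω ^ 2 / t ^ 2)))
      (ENNReal.ofReal c)) :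
    CondLIntegralLe μ m
      (fun ω => ENNReal.ofReal (Real.exp ((Y ω + Z ω) ^ 2 / (s + t) ^ 2)))
      (ENNReal.ofReal c) :=
  (CondLIntegralLe.convex_comb (div_pos hs (add_pos hs ht)).le (div_pos ht (add_pos hs ht)).le
    (by field_simp) (by fun_prop) (by fun_prop) (fun ω => (Real.exp_pos _).le)
    (fun ω => (Real.exp_pos _).le) h1 h2).mono_fun fun ω =>
      ENNReal.ofReal_le_ofReal (exp_sq_add_div_le hs ht _ _)

theorem memLp_two_of_exp_sq {μ : Measure Ω} [IsFiniteMeasure μ] {Y : Ω → ℝ} (hY : Measurable Y)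
    {σ c : ℝ} (hσ : 0 < σ)
    (h : CondLIntegralLe μ m (fun ω => ENNReal.ofReal (Real.exp (Y ω ^ 2 / σ ^ 2)))
      (ENNReal.ofReal c)) : MemLp Y 2 μ := by
  rw [memLp_two_iff_integrable_sq hY.aestronglyMeasurable]
  have hi : Integrable (fun ω => Real.exp (Y ω ^ 2 / σ ^ 2)) μ :=
    h.integrable (by fun_prop) fun ω => (Real.exp_pos _).le
  refine (hi.const_mul (σ ^ 2)).mono' (hY.pow_const 2).aestronglyMeasurable
    (ae_of_all _ fun ω => ?_)
  rw [Real.norm_eq_abs, abs_of_nonneg (sq_nonneg _)]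
  have h1 := Real.add_one_le_exp (Y ω ^ 2 / σ ^ 2)
  have h2 : Y ω ^ 2 / σ ^ 2 ≤ Real.exp (Y ω ^ 2 / σ ^ 2) := by linarith
  rwa [div_le_iff₀ (by positivity), mul_comm] at h2

end PsiTwo

/-! ### Past states as functions of the initial state, attacks and noises -/

section Generators

variable {Ω : Type*} {n : ℕ} {A : Matrix (Fin n) (Fin n) ℝ} {x w v : ℕ → Ω → Vec n} {T : ℕ}

theorem Dynamics.hist_le_generators (hdyn : Dynamics A x w v T) {t : ℕ} (ht : t < T) :
    hist x t ≤ sigmaOf (x 0) ⊔ (⨆ s : ℕ, ⨆ _ : s ≤ t, sigmaOf (v s)) ⊔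
      (⨆ s : ℕ, ⨆ _ : s < t, sigmaOf (w s)) := by
  set H := sigmaOf (x 0) ⊔ (⨆ s : ℕ, ⨆ _ : s ≤ t, sigmaOf (v s)) ⊔
      (⨆ s : ℕ, ⨆ _ : s < t, sigmaOf (w s)) with hH
  have hv : ∀ s ≤ t, Measurable[H] (v s) := fun s hs => (comap_measurable (v s)).mono
    (((le_iSup₂_of_le (f := fun s (_ : s ≤ t) => sigmaOf (v s)) s hs le_rfl).trans
      le_sup_right).trans le_sup_left) le_rfl
  have hw : ∀ s < t, Measurable[H] (w s) := fun s hs => (comap_measurable (w s)).mono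
    ((le_iSup₂_of_le (f := fun s (_ : s < t) => sigmaOf (w s)) s hs le_rfl).trans
      le_sup_right) le_rfl
  have hx : ∀ s ≤ t, Measurable[H] (x s) := by
    intro s
    induction s with
    | zero => exact fun _ => (comap_measurable (x 0)).mono (le_sup_left.trans le_sup_left) le_rfl
    | succ s ih =>
      intro hs
      have e : x (s + 1) = fun ω => Matrix.toEuclideanCLM (𝕜 := ℝ) A (x s ω) + w s ω + v s ω :=
        funext fun ω => hdyn s (by omega) ω
      rw [e]
      exact Measurable.add (m := H) (Measurable.add (m := H)
        ((Matrix.toEuclideanCLM (𝕜 := ℝ) A).continuous.measurable.comp (ih (by omega)))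
        (hw s (by omega))) (hv s (by omega))
  exact iSup₂_le fun s hs => (hx s hs).comap_le

end Generators

/-! ### Consequences of the model assumptions -/

section System

variable {Ω : Type*} [m0 : MeasurableSpace Ω] {n : ℕ} {A : Matrix (Fin n) (Fin n) ℝ}
  {μ : Measure Ω} {x w v : ℕ → Ω → Vec n} {T : ℕ} {σw σv : ℝ}

theorem SubGaussianNoiseAttack.measurable_state (hna : SubGaussianNoiseAttack μ x w v σw σv T)
    (hdyn : Dynamics A x w v T) : ∀ t ≤ T, Measurable (x t) := by
  intro t
  induction t with
  | zero => exact fun _ => hna.meas_init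
  | succ t ih =>
    intro ht
    have e : x (t + 1) = fun ω => Matrix.toEuclideanCLM (𝕜 := ℝ) A (x t ω) + w t ω + v t ω :=
      funext fun ω => hdyn t ht ω
    rw [e]
    exact (((Matrix.toEuclideanCLM (𝕜 := ℝ) A).continuous.measurable.comp (ih (by omega))).add
      (hna.meas_noise t ht)).add (hna.meas_attack t ht)

variable [IsProbabilityMeasure μ]

/-- Every innovation is conditionally sub-Gaussian given the past states. -/
theorem SubGaussianNoiseAttack.innov_exp_sq_le
    (hna : SubGaussianNoiseAttack μ x w v σw σv T) (hdyn : Dynamics A x w v T) (hσw : 0 < σw)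
    (hσv : 0 < σv) {s : ℕ} (hs : s ≤ T) (u : Vec n) (hu : ‖u‖ ≤ 1) :
    CondLIntegralLe μ (histBefore x s) (fun ω => ENNReal.ofReal (Real.exp
      ((inner ℝ u (innov (Matrix.toEuclideanCLM (𝕜 := ℝ) A) x s ω)) ^ 2 / (σw + σv) ^ 2)))
      (ENNReal.ofReal 2) := by
  refine condLIntegralLe_exp_of_unit (fun u hu => ?_) u hu
  have hin : Measurable fun y : Vec n => inner ℝ u y := by fun_prop
  have hexp : ∀ σ : ℝ, Measurable fun y : Vec n => Real.exp ((inner ℝ u y) ^ 2 / σ ^ 2) :=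
    fun σ => by fun_prop
  have hx := hna.measurable_state hdyn
  cases s with
  | zero =>
    obtain ⟨h1, h2⟩ := hna.init_psi2 u hu
    exact (condLIntegralLe_of_indep bot_le le_rfl (indep_bot_right m0) h1
      ((hexp σv).comp hna.meas_init) (fun ω => (Real.exp_pos _).le) h2).exp_mono hσv
      (by linarith)
  | succ s =>
    have hs' : s < T := hs
    have hH : hist x s ≤ m0 := hist_le fun r hr => hx r (by omega)
    obtain ⟨h1, h2⟩ := hna.noise_psi2 s hs' u hu
    obtain ⟨h3, h4⟩ := hna.attack_psi2 s hs' u hu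
    have hw := condLIntegralLe_of_indep hH (hna.meas_noise s hs').comap_le
      (indep_of_indep_of_le_right (hna.noise_indep s hs') (hdyn.hist_le_generators hs')) h1
      ((hexp σw).comp (comap_measurable (w s))) (fun ω => (Real.exp_pos _).le) h2
    have hv := condLIntegralLe_of_condExp_le hH (by norm_num) h3
      (fun ω => (Real.exp_pos _).le) h4
    refine (CondLIntegralLe.exp_add hσw hσv (hin.comp (hna.meas_noise s hs'))
      (hin.comp (hna.meas_attack s hs')) hw hv).mono_fun fun ω => le_of_eq ?_
    have e : innov (Matrix.toEuclideanCLM (𝕜 := ℝ) A) x (s + 1) ω = w s ω + v s ω := by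
      simp only [innov, hdyn s hs' ω]; abel
    rw [e, inner_add_right]
    rfl

theorem SubGaussianNoiseAttack.memLp_inner_state
    (hna : SubGaussianNoiseAttack μ x w v σw σv T) (hdyn : Dynamics A x w v T) (hσw : 0 < σw)
    (hσv : 0 < σv) : ∀ t ≤ T, ∀ u : Vec n, MemLp (fun ω => inner ℝ u (x t ω)) 2 μ := by
  set L := Matrix.toEuclideanCLM (𝕜 := ℝ) A with hL
  have hx := hna.measurable_state hdyn
  have hinn : ∀ t ≤ T, ∀ u : Vec n, MemLp (fun ω => inner ℝ u (innov L x t ω)) 2 μ := by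
    intro t ht u
    have hm : Measurable (innov L x t) := (measurable_innov_hist L x le_rfl).mono
      (hist_le fun s hs => hx s (by omega)) le_rfl
    -- Dividing by `‖u‖ + 1` rather than `‖u‖` covers `u = 0` as well.
    have hu : ‖(‖u‖ + 1)⁻¹ • u‖ ≤ 1 := by
      rw [norm_smul, norm_inv, Real.norm_of_nonneg (by positivity)]
      exact inv_mul_le_one_of_le₀ (by linarith) (by positivity)
    have hin : Measurable fun y : Vec n => inner ℝ ((‖u‖ + 1)⁻¹ • u) y := by fun_prop
    have h := memLp_two_of_exp_sq (hin.comp hm) (add_pos hσw hσv)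
      (hna.innov_exp_sq_le hdyn hσw hσv ht _ hu)
    refine (h.const_mul (‖u‖ + 1)).ae_eq (ae_of_all _ fun ω => ?_)
    simp only [Function.comp, real_inner_smul_left]
    rw [← mul_assoc, mul_inv_cancel₀ (by positivity), one_mul]
  intro t
  induction t with
  | zero => exact fun h u => hinn 0 h u
  | succ t ih =>
    intro ht u
    refine ((ih (by omega) (L.adjoint u)).add (hinn (t + 1) ht u)).ae_eq
      (ae_of_all _ fun ω => ?_)
    simp only [Pi.add_apply, ContinuousLinearMap.adjoint_inner_left, innov]
    rw [← inner_add_right]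
    congr 1; abel

/-- The matrix inequality is evaluated as a quadratic form at `d`. Integrating over a set of the
past replaces the conditional second moments by the products themselves, which is the form the
small-ball estimate uses. -/
theorem ExpectedExcitation.setIntegral_ge {l : ℝ} (hexc : ExpectedExcitation μ x l T)
    (hx : ∀ t ≤ T, Measurable (x t))
    (hx2 : ∀ t ≤ T, ∀ u : Vec n, MemLp (fun ω => inner ℝ u (x t ω)) 2 μ) {t : ℕ} (ht : t < T)
    {B : Set Ω} (hB : MeasurableSet[hist x t] B) (d : Vec n) :
    l ^ 2 * ‖d‖ ^ 2 * μ.real B ≤ ∫ ω in B, (inner ℝ d (x (t + 1) ω)) ^ 2 ∂μ := by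
  have hH : hist x t ≤ m0 := hist_le fun r hr => hx r (by omega)
  have hcoord : ∀ j, MemLp (fun ω => x (t + 1) ω j) 2 μ := fun j => by
    refine (hx2 (t + 1) ht (EuclideanSpace.single j 1)).ae_eq (ae_of_all _ fun ω => ?_)
    simp [EuclideanSpace.inner_single_left]
  have hprod : ∀ j k, Integrable (fun ω => x (t + 1) ω j * x (t + 1) ω k) μ := fun j k =>
    (hcoord j).integrable_mul (hcoord k)
  have hcond : ∀ j k, Integrable (fun ω => d j * d k *
      (μ[fun ω' => x (t + 1) ω' j * x (t + 1) ω' k | hist x t]) ω) (μ.restrict B) :=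
    fun j k => (integrable_condExp.const_mul _).integrableOn
  have hquad : ∀ ω, (inner ℝ d (x (t + 1) ω)) ^ 2
      = ∑ j, ∑ k, d j * d k * (x (t + 1) ω j * x (t + 1) ω k) := fun ω => by
    rw [PiLp.inner_apply, sq, Finset.sum_mul_sum]
    refine Finset.sum_congr rfl fun j _ => Finset.sum_congr rfl fun k _ => ?_
    simp only [RCLike.inner_apply, conj_trivial]
    ring
  have hnorm : ‖d‖ ^ 2 = ∑ j, d j ^ 2 := by
    rw [EuclideanSpace.real_norm_sq_eq]
  simp only [hquad]
  rw [integral_finsetSum _ fun j _ => (integrable_finsetSum _ fun k _ =>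
    (hprod j k).const_mul _).integrableOn]
  have h1 : ∀ j, ∫ ω in B, ∑ k, d j * d k * (x (t + 1) ω j * x (t + 1) ω k) ∂μ
      = ∫ ω in B, ∑ k, d j * d k *
        (μ[fun ω' => x (t + 1) ω' j * x (t + 1) ω' k | hist x t]) ω ∂μ := fun j => by
    rw [integral_finsetSum _ fun k _ => ((hprod j k).const_mul _).integrableOn,
      integral_finsetSum _ fun k _ => hcond j k]
    refine Finset.sum_congr rfl fun k _ => ?_
    rw [integral_const_mul, integral_const_mul, setIntegral_condExp hH (hprod j k) hB]
  simp only [h1]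
  rw [← integral_finsetSum _ fun j _ => integrable_finsetSum _ fun k _ => hcond j k]
  calc l ^ 2 * ‖d‖ ^ 2 * μ.real B = ∫ _ in B, l ^ 2 * ‖d‖ ^ 2 ∂μ := by simp [mul_comm]
    _ ≤ _ := by
      refine integral_mono_ae (integrable_const _).integrableOn
        (integrable_finsetSum _ fun j _ => integrable_finsetSum _ fun k _ => hcond j k) (ae_restrict_of_ae ?_)
      filter_upwards [hexc t ht] with ω hω
      have h2 := hω.dotProduct_mulVec_nonneg (fun j => d j)
      simp only [Matrix.sub_mulVec, dotProduct_sub, Matrix.smul_mulVec, Matrix.one_mulVec,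
        dotProduct_smul, smul_eq_mul, star_trivial] at h2
      have h3 : (fun j => d j) ⬝ᵥ (fun j => d j) = ‖d‖ ^ 2 := by
        rw [hnorm]; simp [dotProduct, sq]
      rw [h3] at h2
      have h4 : (fun j => d j) ⬝ᵥ ((Matrix.of fun j k : Fin n =>
          (μ[fun ω' => x (t + 1) ω' j * x (t + 1) ω' k | hist x t]) ω).mulVec fun j => d j)
          = ∑ j, ∑ k, d j * d k *
          (μ[fun ω' => x (t + 1) ω' j * x (t + 1) ω' k | hist x t]) ω := by
        simp only [dotProduct, Matrix.mulVec, Matrix.of_apply, Finset.mul_sum]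
        refine Finset.sum_congr rfl fun j _ => Finset.sum_congr rfl fun k _ => by ring
      rw [h4] at h2
      linarith

end System

/-! ### A direction governed by the spectral radius -/

section SpectralRadius

variable {n : ℕ}

theorem norm_le_specRad {A : Matrix (Fin n) (Fin n) ℝ} {z : ℂ}
    (hz : z ∈ spectrum ℂ (A.map (algebraMap ℝ ℂ))) : ‖z‖ ≤ specRad A := by
  have hne : spectralRadius ℂ (A.map (algebraMap ℝ ℂ)) ≠ ⊤ := by
    obtain ⟨M, hM⟩ := ((Matrix.finite_spectrum (A.map (algebraMap ℝ ℂ))).image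
      (fun k => ‖k‖₊)).bddAbove
    exact ((iSup₂_le fun k hk => ENNReal.coe_le_coe.2 (hM ⟨k, hk, rfl⟩)).trans_lt
      (ENNReal.coe_lt_top (r := M))).ne
  have h : ((‖z‖₊ : NNReal) : ENNReal) ≤ spectralRadius ℂ (A.map (algebraMap ℝ ℂ)) :=
    le_iSup₂ (f := fun (k : ℂ) (_ : k ∈ spectrum ℂ (A.map (algebraMap ℝ ℂ))) =>
      ((‖k‖₊ : NNReal) : ENNReal)) z hz
  simpa [specRad] using ENNReal.toReal_mono hne h

theorem adjoint_toEuclideanCLM_apply (A : Matrix (Fin n) (Fin n) ℝ) (u : Vec n) (k : Fin n) :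
    (Matrix.toEuclideanCLM (𝕜 := ℝ) A).adjoint u k = ∑ j, u j * A j k := by
  rw [← ContinuousLinearMap.star_eq_adjoint, ← map_star, Matrix.ofLp_toEuclideanCLM]
  simp [Matrix.mulVec, dotProduct, mul_comm]

/-- Some direction is expanded by the transpose by at most the spectral radius. -/
theorem exists_norm_adjoint_le_specRad [NeZero n] (A : Matrix (Fin n) (Fin n) ℝ) :
    ∃ u : Vec n, ‖u‖ = 1 ∧ ‖(Matrix.toEuclideanCLM (𝕜 := ℝ) A).adjoint u‖ ≤ specRad A := by
  set L := Matrix.toEuclideanCLM (𝕜 := ℝ) A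
  suffices h : ∃ u : Vec n, u ≠ 0 ∧ ‖L.adjoint u‖ ≤ specRad A * ‖u‖ by
    obtain ⟨u, hu0, hu⟩ := h
    have hn : ‖u‖ ≠ 0 := norm_ne_zero_iff.2 hu0
    refine ⟨‖u‖⁻¹ • u, by rw [norm_smul, norm_inv, norm_norm, inv_mul_cancel₀ hn], ?_⟩
    rw [map_smul, norm_smul, norm_inv, norm_norm, inv_mul_le_iff₀ (by positivity), mul_comm]
    exact hu
  obtain ⟨z, hz⟩ := spectrum.nonempty_of_isAlgClosed_of_finiteDimensional ℂ
    (A.map (algebraMap ℝ ℂ))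
  have hzρ := norm_le_specRad hz
  have hdet : (algebraMap ℂ (Matrix (Fin n) (Fin n) ℂ) z - A.map (algebraMap ℝ ℂ)).det = 0 := by
    rw [spectrum.mem_iff, Matrix.isUnit_iff_isUnit_det, isUnit_iff_ne_zero, not_not] at hz
    exact hz
  -- A complex left eigenvector. Its real and imaginary parts `a`, `b` satisfy `‖Lᵀa‖² + ‖Lᵀb‖² =
  -- |z|²(‖a‖² + ‖b‖²)`, so a nonzero one of them is expanded by at most `|z|`.
  obtain ⟨c, hc0, hc⟩ := Matrix.exists_vecMul_eq_zero_iff.2 hdet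
  have heig : ∀ k, ∑ j, c j * (A j k : ℂ) = z * c k := fun k => by
    have h := congrFun hc k
    rw [Matrix.vecMul_sub, Algebra.algebraMap_eq_smul_one, Matrix.vecMul_smul,
      Matrix.vecMul_one] at h
    simp only [Pi.sub_apply, Pi.smul_apply, smul_eq_mul, Pi.zero_apply, Matrix.vecMul,
      dotProduct, Matrix.map_apply, Complex.coe_algebraMap] at h
    exact (sub_eq_zero.1 h).symm
  set a : Vec n := WithLp.toLp 2 fun j => (c j).re with ha
  set b : Vec n := WithLp.toLp 2 fun j => (c j).im with hb
  have hre : ∀ k, L.adjoint a k = (z * c k).re := fun k => by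
    rw [adjoint_toEuclideanCLM_apply, ← heig, Complex.re_sum]
    simp [ha]
  have him : ∀ k, L.adjoint b k = (z * c k).im := fun k => by
    rw [adjoint_toEuclideanCLM_apply, ← heig, Complex.im_sum]
    simp [hb]
  have hsum : ‖L.adjoint a‖ ^ 2 + ‖L.adjoint b‖ ^ 2 = ‖z‖ ^ 2 * (‖a‖ ^ 2 + ‖b‖ ^ 2) := by
    simp only [EuclideanSpace.real_norm_sq_eq, hre, him]
    rw [← Finset.sum_add_distrib, ← Finset.sum_add_distrib, Finset.mul_sum]
    refine Finset.sum_congr rfl fun k _ => ?_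
    simp only [ha, hb, Complex.mul_re, Complex.mul_im, Complex.sq_norm, Complex.normSq_apply]
    ring
  by_contra! hcon
  have hρ0 : 0 ≤ specRad A := (norm_nonneg z).trans hzρ
  have hstep : ∀ u : Vec n, u ≠ 0 → ‖z‖ ^ 2 * ‖u‖ ^ 2 < ‖L.adjoint u‖ ^ 2 := fun u hu => by
    rw [← mul_pow]
    exact pow_lt_pow_left₀ ((mul_le_mul_of_nonneg_right hzρ (norm_nonneg u)).trans_lt
      (hcon u hu)) (by positivity) (by norm_num)
  have hstep' : ∀ u : Vec n, ‖z‖ ^ 2 * ‖u‖ ^ 2 ≤ ‖L.adjoint u‖ ^ 2 := fun u => by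
    rcases eq_or_ne u 0 with rfl | hu
    · simp
    · exact (hstep u hu).le
  have hab : a = 0 ∧ b = 0 := by
    constructor
    · by_contra h
      linarith [hstep a h, hstep' b]
    · by_contra h
      linarith [hstep b h, hstep' a]
  refine hc0 (funext fun j => Complex.ext ?_ ?_)
  · simpa [ha] using congrArg (fun y : Vec n => y j) hab.1
  · simpa [hb] using congrArg (fun y : Vec n => y j) hab.2

end SpectralRadius

/-! ### The excitation level against the noise level -/

section Excitation

variable {Ω : Type*} {m m' : MeasurableSpace Ω} [m0 : MeasurableSpace Ω]

theorem CondLIntegralLe.mono_sigma {μ : Measure Ω} {f : Ω → ENNReal}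
    {c : ENNReal} (h : CondLIntegralLe μ m f c) (hm : m' ≤ m) : CondLIntegralLe μ m' f c :=
  fun B hB => h B (hm B hB)

theorem integral_sq_le_of_exp_sq {μ : Measure Ω} [IsProbabilityMeasure μ] {Y : Ω → ℝ}
    (hY : Measurable Y) {σ : ℝ} (hσ : 0 < σ)
    (h : CondLIntegralLe μ m (fun ω => ENNReal.ofReal (Real.exp (Y ω ^ 2 / σ ^ 2)))
      (ENNReal.ofReal 2)) : ∫ ω, Y ω ^ 2 ∂μ ≤ Real.log 2 * σ ^ 2 := by
  have hm : Measurable fun ω => Real.exp (Y ω ^ 2 / σ ^ 2) := by fun_prop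
  have hi : Integrable (fun ω => Real.exp (Y ω ^ 2 / σ ^ 2)) μ :=
    h.integrable hm fun ω => (Real.exp_pos _).le
  have h1 := h.setIntegral_le (by norm_num) hm (fun ω => (Real.exp_pos _).le)
    (B := Set.univ) MeasurableSet.univ
  rw [setIntegral_univ, probReal_univ, mul_one] at h1
  have hσ2 : 0 < σ ^ 2 := by positivity
  calc ∫ ω, Y ω ^ 2 ∂μ
      ≤ ∫ ω, σ ^ 2 * (Real.exp (Y ω ^ 2 / σ ^ 2) / 2 + (Real.log 2 - 1)) ∂μ := by
        refine integral_mono_of_nonneg (ae_of_all _ fun ω => sq_nonneg _)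
          (((hi.div_const 2).add (integrable_const _)).const_mul _) (ae_of_all _ fun ω => ?_)
        -- The tangent to `exp` at `log 2`: Jensen's inequality, giving the constant `log 2`.
        have h2 := Real.add_one_le_exp (Y ω ^ 2 / σ ^ 2 - Real.log 2)
        rw [Real.exp_sub, Real.exp_log (by norm_num)] at h2
        have h3 : Y ω ^ 2 / σ ^ 2 ≤
            Real.exp (Y ω ^ 2 / σ ^ 2) / 2 + (Real.log 2 - 1) := by linarith
        rwa [div_le_iff₀ hσ2, mul_comm] at h3
    _ = σ ^ 2 * ((∫ ω, Real.exp (Y ω ^ 2 / σ ^ 2) ∂μ) / 2 + (Real.log 2 - 1)) := by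
        rw [integral_const_mul, integral_add (hi.div_const 2) (integrable_const _),
          integral_div]
        simp
    _ ≤ σ ^ 2 * (2 / 2 + (Real.log 2 - 1)) := by gcongr
    _ = Real.log 2 * σ ^ 2 := by ring

/-- The excitation level is at most comparable to the sub-Gaussian scale of the disturbances. -/
theorem excitation_le {n : ℕ} [NeZero n] {A : Matrix (Fin n) (Fin n) ℝ} {μ : Measure Ω}
    [IsProbabilityMeasure μ] {x w v : ℕ → Ω → Vec n} {T : ℕ} {σw σv l r : ℝ}
    (hna : SubGaussianNoiseAttack μ x w v σw σv T) (hdyn : Dynamics A x w v T)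
    (hexc : ExpectedExcitation μ x l T) (hσw : 0 < σw) (hσv : 0 < σv) (hT : 0 < T)
    (hr : 0 < r) (hρ : specRad A ≤ r) :
    l ≤ 21 / 25 * ((1 + r) * (σw + σv)) := by
  set σ := σw + σv with hσdef
  have hσ : 0 < σ := add_pos hσw hσv
  set L := Matrix.toEuclideanCLM (𝕜 := ℝ) A with hL
  obtain ⟨u, hu1, hu⟩ := exists_norm_adjoint_le_specRad A
  have hx := hna.measurable_state hdyn
  have hinv : ‖r⁻¹ • L.adjoint u‖ ≤ 1 := by
    rw [norm_smul, norm_inv, Real.norm_of_nonneg hr.le]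
    exact inv_mul_le_one_of_le₀ (hu.trans hρ) hr.le
  have h0 := (hna.innov_exp_sq_le hdyn hσw hσv (Nat.zero_le T) _ hinv).mono_sigma
    (bot_le (a := histBefore x 0))
  have h1 := (hna.innov_exp_sq_le hdyn hσw hσv (s := 1) hT u hu1.le).mono_sigma
    (bot_le (a := histBefore x 1))
  have h0' : CondLIntegralLe μ ⊥ (fun ω => ENNReal.ofReal (Real.exp
      ((inner ℝ (L.adjoint u) (x 0 ω)) ^ 2 / (r * σ) ^ 2))) (ENNReal.ofReal 2) := by
    refine h0.mono_fun fun ω => le_of_eq ?_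
    simp only [innov, real_inner_smul_left, ← hσdef]
    congr 2
    field_simp
  have hin : ∀ d : Vec n, Measurable fun y : Vec n => inner ℝ d y := fun d => by fun_prop
  have hm1 : Measurable (innov L x 1) := (measurable_innov_hist L x le_rfl).mono
      (hist_le fun s hs => hx s (by omega)) le_rfl
  have hadd := CondLIntegralLe.exp_add (mul_pos hr hσ) hσ
    ((hin (L.adjoint u)).comp (hx 0 (Nat.zero_le T))) ((hin u).comp hm1) h0' h1
  have hsq := integral_sq_le_of_exp_sq (((hin (L.adjoint u)).comp (hx 0 (Nat.zero_le T))).add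
    ((hin u).comp hm1)) (by positivity) hadd
  have hB : MeasurableSet[hist x 0] (Set.univ : Set Ω) := MeasurableSet.univ
  have hexc' := hexc.setIntegral_ge hx (hna.memLp_inner_state hdyn hσw hσv) hT hB u
  rw [setIntegral_univ, probReal_univ, hu1] at hexc'
  have e : ∀ ω, (inner ℝ u (x (0 + 1) ω) : ℝ) = (((fun y : Vec n => inner ℝ (L.adjoint u) y) ∘ x 0)
      + ((fun y : Vec n => inner ℝ u y) ∘ innov L x 1) : Ω → ℝ) ω := fun ω => by
    simp only [Pi.add_apply, Function.comp, ContinuousLinearMap.adjoint_inner_left, innov]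
    rw [← inner_add_right]
    congr 1; abel
  simp only [e] at hexc'
  have hle := hexc'.trans hsq
  -- `⟨u, x₁⟩ = ⟨Lᵀu, x₀⟩ + ⟨u, innovation⟩` has `ψ₂` size at most `(1 + r)σ`, and `log 2 <
  -- (21/25)²`.
  have hfin : l ^ 2 ≤ (21 / 25 * ((1 + r) * σ)) ^ 2 := by
    have h2 := Real.log_two_lt_d9
    have h3 : 0 ≤ ((1 + r) * σ) ^ 2 := sq_nonneg _
    have h4 : (r * σ + σ) ^ 2 = ((1 + r) * σ) ^ 2 := by ring
    rw [h4] at hle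
    nlinarith
  exact (abs_le_of_sq_le_sq' hfin (by positivity)).2

end Excitation

/-! ### Sphere nets and pathwise inequalities -/

section Deterministic

variable {n : ℕ}

/-- Cut the cube into cells of side `1/K` by rounding down, and keep one unit vector from each cell
meeting the sphere. Two points of a cell are within `√n/K ≤ n/K`. -/
theorem exists_sphere_net (n K : ℕ) (hK : 0 < K) :
    ∃ N : Finset (Vec n), (∀ d ∈ N, ‖d‖ = 1) ∧ N.card ≤ (2 * K + 1) ^ n ∧
      ∀ d : Vec n, ‖d‖ = 1 → ∃ d' ∈ N, ‖d - d'‖ ≤ n / K := by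
  classical
  have hK0 : (0 : ℝ) < K := by exact_mod_cast hK
  let φ : Vec n → Fin n → ℤ := fun d i => ⌊K * d i⌋
  let g : (Fin n → ℤ) → Vec n := fun f =>
    if h : ∃ d : Vec n, ‖d‖ = 1 ∧ φ d = f then h.choose else 0
  have hg : ∀ f, (∃ d : Vec n, ‖d‖ = 1 ∧ φ d = f) → ‖g f‖ = 1 ∧ φ (g f) = f := fun f h => by
    simp only [g, dif_pos h]
    exact h.choose_spec
  let P : Finset (Fin n → ℤ) := Fintype.piFinset fun _ => Finset.Icc (-(K : ℤ)) K
  refine ⟨(P.filter fun f => ∃ d : Vec n, ‖d‖ = 1 ∧ φ d = f).image g, ?_, ?_, ?_⟩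
  · intro d hd
    obtain ⟨f, hf, rfl⟩ := Finset.mem_image.1 hd
    exact (hg f (Finset.mem_filter.1 hf).2).1
  · refine (Finset.card_image_le.trans (Finset.card_filter_le _ _)).trans (le_of_eq ?_)
    simp only [P, Fintype.card_piFinset, Int.card_Icc, Finset.prod_const, Finset.card_univ,
      Fintype.card_fin]
    congr 1
    omega
  · intro d hd
    have hP : φ d ∈ P := by
      refine Fintype.mem_piFinset.2 fun i => Finset.mem_Icc.2 ?_
      have hi : |d i| ≤ 1 := by
        have := PiLp.norm_apply_le d i
        rwa [hd, Real.norm_eq_abs] at this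
      have := abs_le.1 hi
      constructor
      · refine Int.le_floor.2 ?_
        push_cast
        nlinarith
      · refine Int.cast_le (R := ℝ).1 ((Int.floor_le _).trans ?_)
        push_cast
        nlinarith
    refine ⟨g (φ d), Finset.mem_image_of_mem _ (Finset.mem_filter.2 ⟨hP, d, hd, rfl⟩), ?_⟩
    have hfl := (hg (φ d) ⟨d, hd, rfl⟩).2
    have hcoord : ∀ i, (d - g (φ d)) i ^ 2 ≤ (1 / K : ℝ) ^ 2 := fun i => by
      have h1 : ⌊K * g (φ d) i⌋ = ⌊K * d i⌋ := congrFun hfl i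
      have h2 := Int.abs_sub_lt_one_of_floor_eq_floor h1
      rw [← mul_sub, abs_mul, abs_of_pos hK0, abs_sub_comm] at h2
      rw [← sq_abs]
      refine pow_le_pow_left₀ (abs_nonneg _) ?_ 2
      rw [le_div_iff₀ hK0, mul_comm]
      exact h2.le
    refine abs_le_of_sq_le_sq' ?_ (by positivity) |>.2
    rw [EuclideanSpace.real_norm_sq_eq]
    refine (Finset.sum_le_sum fun i _ => hcoord i).trans ?_
    rw [Finset.sum_const, Finset.card_univ, Fintype.card_fin, nsmul_eq_mul, div_pow, div_pow,
      one_pow, mul_one_div]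
    have : (n : ℝ) ≤ (n : ℝ) ^ 2 := by
      rcases Nat.eq_zero_or_pos n with rfl | h
      · simp
      · have : (1 : ℝ) ≤ n := by exact_mod_cast h
        nlinarith
    gcongr

theorem abs_one_sub_two_boolInd (b : Bool) : |1 - 2 * boolInd b| ≤ 1 := by
  cases b <;> norm_num [boolInd]

/-- The excess of the objective is bounded below by the sign-weighted absolute deviations. -/
theorem signed_sum_le_objective_sub {Ω : Type*} {A : Matrix (Fin n) (Fin n) ℝ}
    {x w v : ℕ → Ω → Vec n} {T : ℕ} (hdyn : Dynamics A x w v T) {i : Fin n} {ξ : ℕ → Ω → Bool}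
    (hξ : ∀ t < T, ∀ ω, ξ t ω = false → v t ω i = 0) (a : Vec n) (ω : Ω) :
    ∑ t ∈ Finset.range T, (1 - 2 * boolInd (ξ t ω)) * |inner ℝ (a - rowVec A i) (x t ω)| ≤
      noiseAwareObj x w T i a ω - noiseAwareObj x w T i (rowVec A i) ω := by
  rw [noiseAwareObj, noiseAwareObj, ← Finset.sum_sub_distrib]
  refine Finset.sum_le_sum fun t ht => ?_
  have ht' := Finset.mem_range.1 ht
  have hrow : (Matrix.toEuclideanCLM (𝕜 := ℝ) A (x t ω)) i = inner ℝ (rowVec A i) (x t ω) := by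
    rw [Matrix.ofLp_toEuclideanCLM, PiLp.inner_apply]
    simp [Matrix.mulVec, dotProduct, rowVec, mul_comm]
  have e : (x (t + 1) ω - w t ω) i = inner ℝ (rowVec A i) (x t ω) + v t ω i := by
    rw [hdyn t ht' ω, ← hrow]
    simp only [PiLp.sub_apply, PiLp.add_apply]
    ring
  rw [e, inner_sub_left]
  set y : ℝ := inner ℝ a (x t ω)
  set z : ℝ := inner ℝ (rowVec A i) (x t ω)
  -- Without an attack the residual at the true row vanishes and equality holds; otherwise the
  -- reverse triangle inequality loses at most `|y - z|`.
  cases h : ξ t ω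
  · rw [hξ t ht' ω h]
    simp [boolInd, abs_sub_comm]
  · have h1 : z + v t ω i - z = v t ω i := by ring
    rw [h1]
    have h2 : v t ω i = (z + v t ω i - y) + (y - z) := by ring
    have h3 := abs_add_le (z + v t ω i - y) (y - z)
    rw [← h2] at h3
    simp only [boolInd, if_true]
    linarith

theorem signed_sum_lipschitz (ξ : ℕ → Bool) (x : ℕ → Vec n) (T : ℕ) (d d' : Vec n) :
    ∑ t ∈ Finset.range T, (1 - 2 * boolInd (ξ t)) * |inner ℝ d' (x t)| -
      ‖d - d'‖ * ∑ t ∈ Finset.range T, ‖x t‖ ≤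
    ∑ t ∈ Finset.range T, (1 - 2 * boolInd (ξ t)) * |inner ℝ d (x t)| := by
  rw [Finset.mul_sum, ← Finset.sum_sub_distrib]
  refine Finset.sum_le_sum fun t _ => ?_
  have h1 : |(1 - 2 * boolInd (ξ t)) * (|inner ℝ d' (x t)| - |inner ℝ d (x t)|)| ≤
      ‖d - d'‖ * ‖x t‖ := by
    rw [abs_mul]
    refine (mul_le_of_le_one_left (abs_nonneg _) (abs_one_sub_two_boolInd _)).trans ?_
    refine (abs_abs_sub_abs_le _ _).trans ?_
    rw [← inner_sub_left, norm_sub_rev]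
    exact abs_real_inner_le_norm _ _
  have h2 := (le_abs_self _).trans h1
  linarith [mul_sub (1 - 2 * boolInd (ξ t)) |inner ℝ d' (x t)| |inner ℝ d (x t)|]

theorem sum_norm_le_of_energy (x : ℕ → Vec n) (T : ℕ) {M : ℝ} (hM : 0 ≤ M)
    (h : ∀ j : Fin n, ∑ t ∈ Finset.range T,
      (inner ℝ (EuclideanSpace.single j (1 : ℝ)) (x t)) ^ 2 ≤ 2 * M ^ 2 * T) :
    ∑ t ∈ Finset.range T, ‖x t‖ ≤ 2 * n * M * T := by
  refine abs_le_of_sq_le_sq' ?_ (by positivity) |>.2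
  have h1 : (∑ t ∈ Finset.range T, ‖x t‖) ^ 2 ≤ T * ∑ t ∈ Finset.range T, ‖x t‖ ^ 2 := by
    simpa using sq_sum_le_card_mul_sum_sq (s := Finset.range T) (f := fun t => ‖x t‖)
  have h2 : ∑ t ∈ Finset.range T, ‖x t‖ ^ 2 ≤ n * (2 * M ^ 2 * T) := by
    simp only [EuclideanSpace.real_norm_sq_eq]
    rw [Finset.sum_comm]
    refine (Finset.sum_le_sum fun j _ => (le_of_eq ?_).trans (h j)).trans (by simp)
    simp [EuclideanSpace.inner_single_left]
  have h3 : (n : ℝ) ≤ (n : ℝ) ^ 2 := by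
    rcases Nat.eq_zero_or_pos n with rfl | h
    · simp
    · have : (1 : ℝ) ≤ n := by exact_mod_cast h
      nlinarith
  calc (∑ t ∈ Finset.range T, ‖x t‖) ^ 2 ≤ T * (n * (2 * M ^ 2 * T)) :=
        h1.trans (by gcongr)
    _ = n * (2 * M ^ 2 * T ^ 2) := by ring
    _ ≤ (n : ℝ) ^ 2 * (4 * M ^ 2 * T ^ 2) := by gcongr; norm_num
    _ = (2 * n * M * T) ^ 2 := by ring

end Deterministic

/-! ### Constants and sample size -/

section Numerics

/-- The exponent multiplier that absorbs the cardinality of the net. -/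
noncomputable def netExponent (ψ : ℝ) : ℝ := 25 + 10 * Real.log (169984 * ψ + 5)

theorem netExponent_ge {ψ : ℝ} (hψ : 0 < ψ) : 25 ≤ netExponent ψ := by
  have := Real.log_nonneg (show 1 ≤ 169984 * ψ + 5 by linarith)
  rw [netExponent]; linarith

theorem log_ge_of_seven_sixths_le {Λ : ℝ} (h : 7 / 6 ≤ Λ) : 1 / 10 ≤ Real.log Λ := by
  have h1 := Real.one_sub_inv_le_log_of_pos (show 0 < Λ by linarith)
  have h2 : Λ⁻¹ ≤ 6 / 7 := by
    rw [inv_le_comm₀ (by linarith) (by norm_num)]; linarith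
  linarith

/-- The net contributes `n(b + 5 log Λ)` to the exponent, where `b = log(169984ψ + 5)`. As `n log Λ
≥ 1/10`, the part `nb` is at most `10b · n log Λ` and the factor `4 ≤ e²` costs at most `20 n log
Λ`; hence `25 + 10b`. -/
theorem net_union_bound {ψ Λ δ : ℝ} {n K : ℕ} (hψ : 0 < ψ) (hn : 0 < n) (hΛ : 7 / 6 ≤ Λ)
    (hδ : 0 < δ) (hδ1 : δ ≤ 1) (hK : (K : ℝ) ≤ 84992 * ψ * Λ ^ 5 + 2) :
    4 * n * (2 * K + 1) ^ n *
      Real.exp (-(netExponent ψ * (n * Real.log Λ + Real.log (n / δ)))) ≤ δ := by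
  have hn1 : (1 : ℝ) ≤ n := by exact_mod_cast hn
  have hΛ0 : 0 < Λ := by linarith
  set y := Real.log Λ with hy
  set z := Real.log (n / δ) with hz
  set b := Real.log (169984 * ψ + 5) with hb
  have hy1 : 1 / 10 ≤ y := log_ge_of_seven_sixths_le hΛ
  have hb0 : 0 ≤ b := Real.log_nonneg (by linarith)
  have hz0 : 0 ≤ z := Real.log_nonneg (by rw [le_div_iff₀ hδ]; linarith)
  have hK1 : (2 * K + 1 : ℝ) ≤ Real.exp (b + 5 * y) := by
    have e : Real.exp (b + 5 * y) = (169984 * ψ + 5) * Λ ^ 5 := by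
      rw [Real.exp_add, hb, Real.exp_log (by linarith)]
      congr 1
      rw [show 5 * y = ((5 : ℕ) : ℝ) * y by norm_num, Real.exp_nat_mul, hy, Real.exp_log hΛ0]
    rw [e]
    have : 1 ≤ Λ ^ 5 := one_le_pow₀ (by linarith)
    nlinarith
  have hKn : (2 * K + 1 : ℝ) ^ n ≤ Real.exp (n * (b + 5 * y)) := by
    rw [Real.exp_nat_mul]
    exact pow_le_pow_left₀ (by positivity) hK1 n
  have h4 : (4 : ℝ) ≤ Real.exp 2 := by
    have := Real.add_one_le_exp (1 : ℝ)
    rw [show (2 : ℝ) = 1 + 1 by norm_num, Real.exp_add]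
    nlinarith
  have hnδ : (n : ℝ) = δ * Real.exp z := by
    rw [hz, Real.exp_log (by positivity)]; field_simp
  calc 4 * n * (2 * K + 1) ^ n * Real.exp (-(netExponent ψ * (n * y + z)))
      ≤ Real.exp 2 * (δ * Real.exp z) * Real.exp (n * (b + 5 * y)) *
        Real.exp (-(netExponent ψ * (n * y + z))) := by
        rw [← hnδ]
        gcongr
    _ = δ * Real.exp (2 + z + n * (b + 5 * y) - netExponent ψ * (n * y + z)) := by
        rw [sub_eq_add_neg, Real.exp_add, Real.exp_add, Real.exp_add]; ring
    _ ≤ δ * 1 := by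
        refine mul_le_mul_of_nonneg_left (Real.exp_le_one_iff.2 ?_) hδ.le
        have h1 : 1 / 10 ≤ n * y := by nlinarith
        have h2 : n * b ≤ 10 * b * (n * y) := by
          nlinarith [mul_le_mul_of_nonneg_left hy1 (mul_nonneg (Nat.cast_nonneg (α := ℝ) n) hb0)]
        have h3 : 0 ≤ b * z := mul_nonneg hb0 hz0
        rw [netExponent, ← hb]
        nlinarith
    _ = δ := mul_one δ

/-- The three conclusions match the three failure modes: energy, excitation count, Bernoulli
deviation. The first two use the first entry of the maximum (`26560 = 20 · 1328`), the third uses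
the second entry. -/
theorem exponent_bounds {ψ ρ p σ l D Q T : ℝ} (hψ : 0 < ψ) (hρ : ρ < 1) (hp0 : 0 ≤ p)
    (hp1 : p < 1 / 2) (hσ : 0 < σ) (hl : 0 < l) (hlσ : l ≤ 2 * σ) (hD : 0 ≤ D) (hQ : 0 ≤ Q)
    (hT : D * (26560 + 8 * 42496 ^ 2 * ψ ^ 2) * (max (σ ^ 4 / (l ^ 4 * (1 - 2 * p)))
      (σ ^ 10 / (l ^ 10 * (1 - 2 * p) ^ 2 * (1 - ρ) ^ 2)) * Q) ≤ T) :
    1660 * (D * Q) ≤ T ∧ D * Q ≤ l ^ 4 / (1328 * σ ^ 4) * T / 20 ∧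
      D * Q ≤ ((1 - 2 * p) * l ^ 5 / (42496 * σ ^ 4) * T) ^ 2 /
        (4 * (2 * (ψ / (1 - ρ)) ^ 2 * σ ^ 2 * T)) := by
  have hp : 0 < 1 - 2 * p := by linarith
  have hρ' : 0 < 1 - ρ := by linarith
  have hDQ : 0 ≤ D * Q := mul_nonneg hD hQ
  have ha : 26560 * (D * Q) * (σ ^ 4 / (l ^ 4 * (1 - 2 * p))) ≤ T := by
    refine le_trans ?_ hT
    calc 26560 * (D * Q) * (σ ^ 4 / (l ^ 4 * (1 - 2 * p)))
        = D * 26560 * (σ ^ 4 / (l ^ 4 * (1 - 2 * p)) * Q) := by ring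
      _ ≤ _ := by
        gcongr
        · have : 0 ≤ 8 * 42496 ^ 2 * ψ ^ 2 := by positivity
          linarith
        · exact le_max_left _ _
  have hb : 8 * 42496 ^ 2 * ψ ^ 2 * (D * Q) *
      (σ ^ 10 / (l ^ 10 * (1 - 2 * p) ^ 2 * (1 - ρ) ^ 2)) ≤ T := by
    refine le_trans ?_ hT
    calc 8 * 42496 ^ 2 * ψ ^ 2 * (D * Q) * (σ ^ 10 / (l ^ 10 * (1 - 2 * p) ^ 2 * (1 - ρ) ^ 2))
        = D * (8 * 42496 ^ 2 * ψ ^ 2) *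
          (σ ^ 10 / (l ^ 10 * (1 - 2 * p) ^ 2 * (1 - ρ) ^ 2) * Q) := by ring
      _ ≤ _ := by
        gcongr
        · linarith
        · exact le_max_right _ _
  have ha' : 26560 * (D * Q) * (σ ^ 4 / l ^ 4) ≤ T := by
    refine le_trans ?_ ha
    gcongr
    exact mul_le_of_le_one_right (by positivity) (by linarith)
  refine ⟨?_, ?_, ?_⟩
  · have h16 : 1 / 16 ≤ σ ^ 4 / l ^ 4 := by
      rw [div_le_div_iff₀ (by norm_num) (by positivity)]
      have := pow_le_pow_left₀ hl.le hlσ 4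
      linarith [show (2 * σ) ^ 4 = 16 * σ ^ 4 by ring]
    nlinarith
  · calc D * Q = l ^ 4 / (1328 * σ ^ 4) * (26560 * (D * Q) * (σ ^ 4 / l ^ 4)) / 20 := by
          field_simp; ring
      _ ≤ _ := by gcongr
  · rcases (show 0 ≤ T from le_trans (by positivity) ha').eq_or_lt with h0 | hT0
    · rw [← h0] at ha' ⊢
      have : 0 < 26560 * (σ ^ 4 / l ^ 4) := by positivity
      have h2 : D * Q ≤ 0 := by
        by_contra h
        push Not at h
        nlinarith [mul_pos h this]
      simpa using h2
    · have e : ((1 - 2 * p) * l ^ 5 / (42496 * σ ^ 4) * T) ^ 2 /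
          (4 * (2 * (ψ / (1 - ρ)) ^ 2 * σ ^ 2 * T)) =
          l ^ 10 * (1 - 2 * p) ^ 2 * (1 - ρ) ^ 2 / (8 * 42496 ^ 2 * ψ ^ 2 * σ ^ 10) * T := by
        field_simp; ring
      rw [e]
      calc D * Q = l ^ 10 * (1 - 2 * p) ^ 2 * (1 - ρ) ^ 2 / (8 * 42496 ^ 2 * ψ ^ 2 * σ ^ 10) *
            (8 * 42496 ^ 2 * ψ ^ 2 * (D * Q) *
            (σ ^ 10 / (l ^ 10 * (1 - 2 * p) ^ 2 * (1 - ρ) ^ 2))) := by field_simp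
        _ ≤ _ := by gcongr

theorem net_size_le {ψ ρ P σ l N : ℝ} (hψ : 0 < ψ) (hρ0 : 0 < ρ) (hρ1 : ρ ≤ 1) (hP0 : 0 < P)
    (hP1 : P ≤ 1) (hσ : 0 < σ) (hl : 0 < l) (hN : 1 ≤ N) :
    84992 * N ^ 2 * (ψ / ρ) * σ ^ 5 / (P * l ^ 5) ≤ 84992 * ψ * (N * σ / (l * P * ρ)) ^ 5 := by
  have e1 : 84992 * N ^ 2 * (ψ / ρ) * σ ^ 5 / (P * l ^ 5) =
      84992 * ψ * (N ^ 2 * σ ^ 5 / (l ^ 5 * P * ρ)) := by field_simp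
  rw [e1, div_pow, mul_pow, mul_pow, mul_pow]
  have hn : N ^ 2 ≤ N ^ 5 := pow_le_pow_right₀ hN (by norm_num)
  have hp : P ^ 5 ≤ P := pow_le_of_le_one hP0.le hP1 (by norm_num)
  have hr : ρ ^ 5 ≤ ρ := pow_le_of_le_one hρ0.le hρ1 (by norm_num)
  have hden : l ^ 5 * P ^ 5 * ρ ^ 5 ≤ l ^ 5 * P * ρ := by gcongr
  have hnum : N ^ 2 * σ ^ 5 ≤ N ^ 5 * σ ^ 5 := by gcongr
  exact mul_le_mul_of_nonneg_left (div_le_div₀ (by positivity) hnum (by positivity) hden)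
    (by positivity)

theorem net_scale_eq {P σ l N K S T : ℝ} (hP : 0 < P) (hσ : 0 < σ) (hl : 0 < l) (hK : 0 < K) :
    N / K * (2 * N * (S * σ) * T) = 84992 * N ^ 2 * S * σ ^ 5 / (P * l ^ 5) / K *
      (P * l ^ 5 / (42496 * σ ^ 4) * T) := by
  field_simp
  ring

end Numerics

/-! ### Assembling the estimates -/

section Main

variable {Ω : Type*} {n : ℕ}

/-- On a sample where the signed sums are large on a net and the basis energies are bounded, the
objective is sharp at the true row. -/
theorem objective_sub_ge {A : Matrix (Fin n) (Fin n) ℝ} {x w v : ℕ → Ω → Vec n} {T K : ℕ}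
    (hdyn : Dynamics A x w v T) {i : Fin n} {ξ : ℕ → Ω → Bool}
    (hξ : ∀ t < T, ∀ ω, ξ t ω = false → v t ω i = 0) {N : Finset (Vec n)}
    (hN : ∀ d : Vec n, ‖d‖ = 1 → ∃ d' ∈ N, ‖d - d'‖ ≤ n / K) {M R : ℝ} (hM : 0 ≤ M)
    (hK : n / K * (2 * n * M * T) ≤ R) {ω : Ω}
    (hE : ∀ j : Fin n, ∑ t ∈ Finset.range T,
      (inner ℝ (EuclideanSpace.single j (1 : ℝ)) (x t ω)) ^ 2 ≤ 2 * M ^ 2 * T)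
    (hs : ∀ d ∈ N, 2 * R ≤
      ∑ t ∈ Finset.range T, (1 - 2 * boolInd (ξ t ω)) * |inner ℝ d (x t ω)|) (a : Vec n) :
    R * ‖a - rowVec A i‖ ≤
      noiseAwareObj x w T i a ω - noiseAwareObj x w T i (rowVec A i) ω := by
  refine le_trans ?_ (signed_sum_le_objective_sub hdyn hξ a ω)
  rcases eq_or_ne (a - rowVec A i) 0 with h0 | h0
  · simp [h0]
  set b := a - rowVec A i
  have hb : 0 < ‖b‖ := norm_pos_iff.2 h0
  have hb1 : ‖‖b‖⁻¹ • b‖ = 1 := by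
    rw [norm_smul, norm_inv, norm_norm, inv_mul_cancel₀ hb.ne']
  obtain ⟨d', hd', hdist⟩ := hN _ hb1
  have h1 := signed_sum_lipschitz (fun t => ξ t ω) (fun t => x t ω) T (‖b‖⁻¹ • b) d'
  have h2 : ‖‖b‖⁻¹ • b - d'‖ * ∑ t ∈ Finset.range T, ‖x t ω‖ ≤ R := le_trans
    (mul_le_mul hdist (sum_norm_le_of_energy (fun t => x t ω) T hM hE)
      (Finset.sum_nonneg fun _ _ => norm_nonneg _) (by positivity)) hK
  have h3 := hs d' hd'
  have h4 : R ≤ ∑ t ∈ Finset.range T,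
      (1 - 2 * boolInd (ξ t ω)) * |inner ℝ (‖b‖⁻¹ • b) (x t ω)| := by linarith
  have h5 : ∑ t ∈ Finset.range T, (1 - 2 * boolInd (ξ t ω)) * |inner ℝ b (x t ω)|
      = ‖b‖ * ∑ t ∈ Finset.range T,
        (1 - 2 * boolInd (ξ t ω)) * |inner ℝ (‖b‖⁻¹ • b) (x t ω)| := by
    rw [Finset.mul_sum]
    refine Finset.sum_congr rfl fun t _ => ?_
    rw [real_inner_smul_left, abs_mul, abs_of_pos (inv_pos.2 hb)]
    field_simp
  rw [h5, mul_comm]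
  exact mul_le_mul_of_nonneg_left h4 hb.le

theorem one_sub_le_measureReal_forall [MeasurableSpace Ω] {μ : Measure Ω} [IsProbabilityMeasure μ]
    {N : Finset (Vec n)} {P : Fin n → Vec n → Ω → Prop} {P' : Fin n → Ω → Prop} {G : Set Ω}
    {a b δ : ℝ} (h1 : ∀ i, ∀ d ∈ N, μ.real {ω | ¬ P i d ω} ≤ a)
    (h2 : ∀ j, μ.real {ω | ¬ P' j ω} ≤ b)
    (hG : ∀ ω, (∀ i, ∀ d ∈ N, P i d ω) → (∀ j, P' j ω) → ω ∈ G)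
    (hδ : n * (N.card * a) + n * b ≤ δ) : 1 - δ ≤ μ.real G := by
  have hcover : (Set.univ : Set Ω) ⊆ G ∪ ((⋃ i ∈ (Finset.univ : Finset (Fin n)), ⋃ d ∈ N,
      {ω | ¬ P i d ω}) ∪ ⋃ j ∈ (Finset.univ : Finset (Fin n)), {ω | ¬ P' j ω}) := by
    intro ω _
    by_contra h
    simp only [Set.mem_union, Set.mem_iUnion, Set.mem_ofPred_eq, not_or, not_exists,
      Finset.mem_univ, not_not, forall_const] at h
    exact h.1 (hG ω h.2.1 h.2.2)
  have hA : μ.real (⋃ i ∈ (Finset.univ : Finset (Fin n)), ⋃ d ∈ N, {ω | ¬ P i d ω}) ≤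
      n * (N.card * a) := by
    refine (measureReal_biUnion_finset_le _ _).trans ?_
    refine (Finset.sum_le_sum fun i _ => (measureReal_biUnion_finset_le _ _).trans
      (Finset.sum_le_sum fun d hd => h1 i d hd)).trans (by simp)
  have hB : μ.real (⋃ j ∈ (Finset.univ : Finset (Fin n)), {ω | ¬ P' j ω}) ≤ n * b :=
    (measureReal_biUnion_finset_le _ _).trans
      ((Finset.sum_le_sum fun j _ => h2 j).trans (by simp))
  have h := (measureReal_mono (μ := μ) hcover).trans ((measureReal_union_le _ _).trans
    (add_le_add le_rfl ((measureReal_union_le _ _).trans (add_le_add hA hB))))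
  rw [probReal_univ] at h
  linarith

end Main

end AttackedSystem

/-! ### The main theorem -/

theorem theorem2 :
    ∃ γ : ℝ, 0 < γ ∧ ∀ ψ : ℝ, 0 < ψ → ∃ C : ℝ, 0 < C ∧
      ∀ (n : ℕ) (A : Matrix (Fin n) (Fin n) ℝ),
        AttackedSystem.specRad A < 1 → AttackedSystem.PowerSumBound A ψ →
      ∀ (Ω : Type*) [MeasurableSpace Ω] (μ : Measure Ω) [IsProbabilityMeasure μ]
        (x w v : ℕ → Ω → AttackedSystem.Vec n) (T : ℕ) (σw σv p l δ : ℝ),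
        0 < σw → 0 < σv → 0 ≤ p → p < 1 / 2 → 0 < l → 0 < δ → δ ≤ 1 →
        AttackedSystem.Dynamics A x w v T →
        AttackedSystem.SubGaussianNoiseAttack μ x w v σw σv T →
        AttackedSystem.NodeWiseAttack μ x v p T →
        AttackedSystem.ExpectedExcitation μ x l T →
        C * (max ((σw + σv) ^ 4 / (l ^ 4 * (1 - 2 * p)))
              ((σw + σv) ^ 10 /
                (l ^ 10 * (1 - 2 * p) ^ 2 * (1 - AttackedSystem.specRad A) ^ 2)) *
            (n * Real.log (n * (σw + σv) / (l * (1 - 2 * p) * (1 - AttackedSystem.specRad A))) +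
              Real.log (n / δ))) ≤ (T : ℝ) →
        1 - δ ≤ μ.real {ω | ∀ (i : Fin n) (a : AttackedSystem.Vec n),
          γ * T * (l ^ 5 * (1 - 2 * p) / (σw + σv) ^ 4) * ‖a - AttackedSystem.rowVec A i‖ ≤
            AttackedSystem.noiseAwareObj x w T i a ω -
              AttackedSystem.noiseAwareObj x w T i (AttackedSystem.rowVec A i) ω} := by
  refine ⟨1 / 42496, by norm_num, fun ψ hψ => ?_⟩
  have hD := AttackedSystem.netExponent_ge hψ
  set D := AttackedSystem.netExponent ψ with hDdef
  refine ⟨D * (26560 + 8 * 42496 ^ 2 * ψ ^ 2), by positivity, ?_⟩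
  intro n A hρ hA Ω _ μ _ x w v T σw σv p l δ hσw hσv hp0 hp1 hl hδ hδ1 hdyn hna hatt hexc hT
  -- At `T = 0` the excitation hypothesis is empty and cannot bound `l`, but both sides of the claim
  -- vanish.
  rcases Nat.eq_zero_or_pos T with rfl | hTpos
  · simp only [AttackedSystem.noiseAwareObj, Finset.range_zero, Finset.sum_empty, Nat.cast_zero,
      mul_zero, zero_mul, sub_zero, le_refl, implies_true, Set.ofPred_true, probReal_univ]
    linarith
  rcases Nat.eq_zero_or_pos n with rfl | hn
  · simp only [IsEmpty.forall_iff, Set.ofPred_true, probReal_univ]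
    linarith
  have : NeZero n := ⟨hn.ne'⟩
  have hn1 : (1 : ℝ) ≤ n := by exact_mod_cast hn
  set σ := σw + σv with hσdef
  have hσ : 0 < σ := add_pos hσw hσv
  set ρ := AttackedSystem.specRad A with hρdef
  have hρ0 : 0 ≤ ρ := ENNReal.toReal_nonneg
  have hρ' : 0 < 1 - ρ := by linarith
  have hp' : 0 < 1 - 2 * p := by linarith
  -- The margin `1/100` keeps `r` positive when `ρ = 0`. It still gives `Λ ≥ 7/6`, since `(1 + r)(1
  -- - ρ) ≤ 1.01` and `0.84 · 1.01 < 6/7`.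
  have hlr := AttackedSystem.excitation_le (r := ρ + 1 / 100) hna hdyn hexc hσw hσv hTpos
    (by linarith) (by linarith)
  rw [← hσdef] at hlr
  have hlσ : l ≤ 2 * σ := by nlinarith
  set Λ := n * σ / (l * (1 - 2 * p) * (1 - ρ)) with hΛdef
  have hΛ : 7 / 6 ≤ Λ := by
    rw [hΛdef, le_div_iff₀ (by positivity)]
    have h1 : l * (1 - 2 * p) * (1 - ρ) ≤ l * (1 - ρ) := by
      gcongr
      exact mul_le_of_le_one_right hl.le (by linarith)
    have h2 : l * (1 - ρ) ≤ 6 / 7 * σ := by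
      calc l * (1 - ρ) ≤ 21 / 25 * ((1 + (ρ + 1 / 100)) * σ) * (1 - ρ) := by gcongr
        _ = 21 / 25 * ((1 + (ρ + 1 / 100)) * (1 - ρ)) * σ := by ring
        _ ≤ 6 / 7 * σ := by
          gcongr
          nlinarith
    nlinarith
  have hy1 := AttackedSystem.log_ge_of_seven_sixths_le hΛ
  have hz0 : 0 ≤ Real.log (n / δ) := Real.log_nonneg (by rw [le_div_iff₀ hδ]; linarith)
  set Q := n * Real.log Λ + Real.log (n / δ) with hQdef
  have hQ : 1 / 10 ≤ Q := by
    rw [hQdef]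
    nlinarith
  obtain ⟨hT1, hT2, hT3⟩ := AttackedSystem.exponent_bounds hψ hρ hp0 hp1 hσ hl hlσ
    (by linarith : 0 ≤ D) (by linarith) hT
  have hDQ : 5 / 2 ≤ D * Q := by nlinarith
  have hT2le : (2 : ℝ) ≤ T := by linarith
  set S := ψ / (1 - ρ) with hSdef
  have hS0 : 0 < S := by positivity
  set L := Matrix.toEuclideanCLM (𝕜 := ℝ) A with hLdef
  have hS : ∑ k ∈ Finset.range T, ‖L ^ k‖ ≤ S := by
    have := hA T
    simpa only [AttackedSystem.opNorm, map_pow] using this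
  -- Chosen so that the net error `n/K · 2nSσT` is at most `R`.
  set K0 := 84992 * (n : ℝ) ^ 2 * S * σ ^ 5 / ((1 - 2 * p) * l ^ 5) with hK0def
  set K := ⌈K0⌉₊ + 1 with hKdef
  have hK00 : 0 ≤ K0 := by positivity
  have hKge : K0 ≤ K := by
    rw [hKdef]; push_cast
    linarith [Nat.le_ceil K0]
  have hKpos : (0 : ℝ) < K := by rw [hKdef]; positivity
  have hKle : (K : ℝ) ≤ 84992 * ψ * Λ ^ 5 + 2 := by
    have h1 : K0 ≤ 84992 * ψ * Λ ^ 5 :=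
      AttackedSystem.net_size_le hψ hρ' (by linarith) hp' (by linarith) hσ hl hn1
    rw [hKdef]; push_cast
    linarith [Nat.ceil_lt_add_one hK00]
  obtain ⟨N, hN1, hNcard, hN⟩ := AttackedSystem.exists_sphere_net n K (Nat.succ_pos _)
  set R := (1 - 2 * p) * l ^ 5 / (42496 * σ ^ 4) * T with hRdef
  have hR0 : 0 ≤ R := by positivity
  obtain ⟨T', rfl⟩ : ∃ T', T = T' + 1 := ⟨T - 1, by omega⟩
  have hx := hna.measurable_state hdyn
  have hψ2 : ∀ s < T' + 1, ∀ u : AttackedSystem.Vec n, ‖u‖ ≤ 1 → AttackedSystem.CondLIntegralLe μ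
      (AttackedSystem.histBefore x s) (fun ω => ENNReal.ofReal (Real.exp
        ((inner ℝ u (AttackedSystem.innov L x s ω)) ^ 2 / σ ^ 2))) (ENNReal.ofReal 2) :=
    fun s hs u hu => hna.innov_exp_sq_le hdyn hσw hσv (by omega) u hu
  have hmem := hna.memLp_inner_state hdyn hσw hσv
  choose ξ hξm hξp hξi hξ0 using hatt
  have hT'ge : ((T' + 1 : ℕ) : ℝ) / 2 ≤ T' := by push_cast at hT2le ⊢; linarith
  refine AttackedSystem.one_sub_le_measureReal_forall (N := N)
    (P := fun i d ω => 2 * R ≤ ∑ t ∈ Finset.range (T' + 1),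
      (1 - 2 * AttackedSystem.boolInd (ξ i t ω)) * |inner ℝ d (x t ω)|)
    (P' := fun j ω => ∑ t ∈ Finset.range (T' + 1),
      (inner ℝ (EuclideanSpace.single j (1 : ℝ)) (x t ω)) ^ 2 ≤ 2 * (S * σ) ^ 2 * (T' + 1 : ℕ))
    (a := 3 * Real.exp (-(D * Q))) (b := Real.exp (-(D * Q))) ?_ ?_ ?_ ?_
  · intro i d hd
    have h := AttackedSystem.measureReal_signed_sum_lt (μ := μ) L x T' hσ hl hlσ hS0 hp0 hp1
      (fun t ht => hx t (by omega)) (hN1 d hd).le hψ2 hS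
      (fun t ht B hB => by
        have := hexc.setIntegral_ge hx hmem (show t < T' + 1 by omega) hB d
        rwa [hN1 d hd, one_pow, mul_one] at this)
      (ξ i) (hξm i) (hξp i) (hξi i) hR0
    refine (measureReal_mono fun ω hω => ?_).trans (h.trans ?_)
    · simp only [Set.mem_ofPred_eq, not_le] at hω ⊢
      refine hω.trans_le ?_
      have h1 : (1 - 2 * p) * (l / 2 * (l ^ 4 / (1328 * σ ^ 4) * (((T' + 1 : ℕ) : ℝ) / 2) / 2))
          ≤ (1 - 2 * p) * (l / 2 * (l ^ 4 / (1328 * σ ^ 4) * T' / 2)) := by gcongr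
      -- The budget is `4R`: the Bernoulli deviation takes `2R`, the net takes `R`, and `R` remains.
      -- Together with `T' ≥ T/2` this produces `42496 = 32 · 1328`.
      have h2 : (1 - 2 * p) * (l / 2 * (l ^ 4 / (1328 * σ ^ 4) * (((T' + 1 : ℕ) : ℝ) / 2) / 2))
          = 4 * R := by rw [hRdef]; field_simp; ring
      linarith
    · have e1 : Real.exp (-((T' + 1 : ℕ) : ℝ)) ≤ Real.exp (-(D * Q)) :=
        Real.exp_le_exp.2 (by linarith)
      have e2 : Real.exp (-(l ^ 4 / (1328 * σ ^ 4) * T' / 10)) ≤ Real.exp (-(D * Q)) := by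
        refine Real.exp_le_exp.2 (neg_le_neg (hT2.trans ?_))
        calc l ^ 4 / (1328 * σ ^ 4) * ((T' + 1 : ℕ) : ℝ) / 20
            = l ^ 4 / (1328 * σ ^ 4) * (((T' + 1 : ℕ) : ℝ) / 2) / 10 := by ring
          _ ≤ _ := by gcongr
      have e3 : Real.exp (-(R ^ 2 / (4 * (2 * S ^ 2 * σ ^ 2 * (T' + 1 : ℕ))))) ≤
          Real.exp (-(D * Q)) := Real.exp_le_exp.2 (neg_le_neg hT3)
      linarith
  · intro j
    have h := AttackedSystem.measureReal_energy_le (μ := μ) L x (T' + 1) hσ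
      (fun t ht => hx t (by omega)) hψ2 hS (d := EuclideanSpace.single j (1 : ℝ)) (by simp)
    refine (measureReal_mono fun ω hω => ?_).trans (h.trans
      (Real.exp_le_exp.2 (by linarith)))
    simp only [Set.mem_ofPred_eq, not_le] at hω ⊢
    rwa [mul_pow, ← mul_assoc] at hω
  · intro ω h1 h2 i a
    have hKR : n / K * (2 * n * (S * σ) * (T' + 1 : ℕ)) ≤ R := by
      rw [AttackedSystem.net_scale_eq hp' hσ hl hKpos]
      exact mul_le_of_le_one_left hR0 ((div_le_one hKpos).2 hKge)
    have h := AttackedSystem.objective_sub_ge hdyn (hξ0 i) hN (by positivity) hKR h2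
      (fun d hd => h1 i d hd) a
    refine le_trans (le_of_eq ?_) h
    rw [hRdef]; field_simp
  · have h1 := AttackedSystem.net_union_bound hψ hn hΛ hδ hδ1 hKle
    rw [← hDdef, ← hQdef] at h1
    refine le_trans ?_ h1
    have h2 : (N.card : ℝ) ≤ (2 * K + 1) ^ n := by exact_mod_cast hNcard
    have h3 : (1 : ℝ) ≤ (2 * K + 1) ^ n := one_le_pow₀ (by linarith)
    -- Three failure modes for each row and net point, plus one energy event for each coordinate.
    calc n * (N.card * (3 * Real.exp (-(D * Q)))) + n * Real.exp (-(D * Q))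
        = n * (3 * N.card + 1) * Real.exp (-(D * Q)) := by ring
      _ ≤ n * (4 * (2 * K + 1) ^ n) * Real.exp (-(D * Q)) := by
        gcongr
        linarith
      _ = _ := by ring
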